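/- Let $k\ge 6$, let $T$ be the $(k+1)$-regular tree (every vertex has exactly $k+1$ neighbours) and let $O$ be a fixed vertex of $T$, the root. Let $A_{k+1}$ be the group of all graph automorphisms of $T$ that fix $O$, with the topology of pointwise convergence on the vertices; it is a profinite group. For $j\ge 1$, every $x\in A_{k+1}$ permutes the finite set of vertices at distance $j$ from $O$. Let $A^+_{k+1}$ be the closed subgroup of those $x\in A_{k+1}$ whose permutation of the sphere of radius $j$ is even for every $j\ge 1$. For a compact group $G$ with normalized Haar measure $\mu$ (so $\mu(G)=1$), let the product-free measure of $G$ be $$\mathrm{pf}(G)=\sup\{\mu(A) : A\subseteq G \text{ measurable},\ A\cap A^2=\emptyset\},\qquad A^2=\{ab : a,b\in A\}.$$ Then $$\frac{1}{k+1}\ \le\ \mathrm{pf}(A^+_{k+1})\ \le\ \frac{1}{(k-1)^{1/3}}.$$ Moreover, every non-trivial continuous representation $\rho: A^+_{k+1}\to \mathrm{GL}_d(\mathbb{C})$ has degree $d\ge k-1$. -/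

import Mathlib

open scoped Pointwise

/-- Vertices of the `(k+1)`-regular rooted tree, coded by the path leading to them from the root:
the first step is one of `k + 1` choices, each later step one of `k` choices. In `node i w` the
first step is `i` and `w` lists the later steps, the last step first. -/
inductive TreeVertex (k : ℕ) : Type
  | root : TreeVertex k
  | node (i : Fin (k + 1)) (w : List (Fin k)) : TreeVertex k
deriving DecidableEq

namespace TreeVertex

/-- `u.IsParent v`: the vertex `v` is reached from `u` by one further step. -/
inductive IsParent {k : ℕ} : TreeVertex k → TreeVertex k → Prop
  | first (i : Fin (k + 1)) : IsParent root (node i [])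
  | later (i : Fin (k + 1)) (w : List (Fin k)) (a : Fin k) : IsParent (node i w) (node i (a :: w))

/-- The number of steps leading from the root to a vertex. -/
def depth {k : ℕ} : TreeVertex k → ℕ
  | root => 0
  | node _ w => w.length + 1

/-- The previous vertex on the path from the root (the root itself for the root). -/
def parent {k : ℕ} : TreeVertex k → TreeVertex k
  | root => root
  | node _ [] => root
  | node i (_ :: w) => node i w

theorem IsParent.depth_eq {k : ℕ} {u v : TreeVertex k} (h : u.IsParent v) :
    v.depth = u.depth + 1 := by
  cases h <;> simp [depth]

theorem IsParent.parent_eq {k : ℕ} {u v : TreeVertex k} (h : u.IsParent v) : v.parent = u := by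
  cases h <;> rfl

theorem parent_isParent {k : ℕ} {v : TreeVertex k} (h : v ≠ root) : v.parent.IsParent v := by
  match v with
  | root => exact absurd rfl h
  | node i [] => exact IsParent.first i
  | node i (a :: w) => exact IsParent.later i w a

theorem depth_parent_le {k : ℕ} (v : TreeVertex k) : v.parent.depth ≤ v.depth := by
  by_cases h : v = root
  · subst h; exact le_rfl
  · have := (parent_isParent h).depth_eq; omega

theorem depth_parent_iterate_le {k : ℕ} (n : ℕ) (v : TreeVertex k) :
    (parent^[n] v).depth ≤ v.depth := by
  induction n with
  | zero => exact le_rfl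
  | succ n ih =>
    rw [Function.iterate_succ_apply']
    exact (depth_parent_le _).trans ih

end TreeVertex

/-- The `(k+1)`-regular tree: every vertex is joined to its parent. -/
def regTree (k : ℕ) : SimpleGraph (TreeVertex k) where
  Adj u v := u.IsParent v ∨ v.IsParent u
  symm := ⟨fun _ _ h => h.symm⟩
  loopless := ⟨fun u h => by
    have : u.IsParent u := h.elim id id
    have := this.depth_eq
    omega⟩

namespace regTree

open TreeVertex

theorem exists_walk_root {k : ℕ} (v : TreeVertex k) :
    ∃ p : (regTree k).Walk root v, p.length = v.depth := by
  obtain ⟨n, hn⟩ : ∃ n, v.depth = n := ⟨_, rfl⟩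
  induction n generalizing v with
  | zero =>
    match v, hn with
    | root, _ => exact ⟨SimpleGraph.Walk.nil, rfl⟩
  | succ n ih =>
    have hv : v ≠ root := by
      rintro rfl
      simp [depth] at hn
    have hp := parent_isParent hv
    have hd := hp.depth_eq
    obtain ⟨p, hl⟩ := ih v.parent (by omega)
    have hadj : (regTree k).Adj v.parent v := Or.inl hp
    refine ⟨p.concat hadj, ?_⟩
    rw [SimpleGraph.Walk.length_concat, hl, hd]

theorem depth_le_of_walk {k : ℕ} {u v : TreeVertex k} (p : (regTree k).Walk u v) :
    v.depth ≤ u.depth + p.length := by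
  induction p with
  | nil => simp
  | cons h p ih =>
    rw [SimpleGraph.Walk.length_cons]
    rcases h with h | h <;> have := h.depth_eq <;> omega

protected theorem connected (k : ℕ) : (regTree k).Connected := by
  have h : ∀ v, (regTree k).Reachable root v := fun v => (exists_walk_root v).choose.reachable
  exact { preconnected := fun u v => (h u).symm.trans (h v), nonempty := ⟨root⟩ }

/-- Graph distance from the root is the number of steps. -/
theorem dist_root {k : ℕ} (v : TreeVertex k) : (regTree k).dist root v = v.depth := by
  apply le_antisymm
  · obtain ⟨p, hp⟩ := exists_walk_root v
    exact hp ▸ SimpleGraph.dist_le p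
  · obtain ⟨p, hp⟩ := (regTree.connected k).exists_walk_length_eq_dist root v
    have h1 := depth_le_of_walk p
    have h0 : (root : TreeVertex k).depth = 0 := rfl
    omega

theorem isTree (k : ℕ) : (regTree k).IsTree := by
  refine ⟨regTree.connected k, ?_⟩
  have key : ∀ p c : TreeVertex k, p.IsParent c → (regTree k).IsBridge s(c, p) := by
    intro p c hpc
    rw [SimpleGraph.isBridge_iff]
    rintro ⟨q⟩
    have hq : ∀ {x y : TreeVertex k} (_ : ((regTree k).deleteEdges {s(c, p)}).Walk x y),
        (∃ n, parent^[n] x = c) → ∃ n, parent^[n] y = c := by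
      intro x y q
      induction q with
      | nil => exact id
      | cons h _ ih =>
        rename_i u v w
        rintro ⟨n, hn⟩
        apply ih
        rw [SimpleGraph.deleteEdges_adj] at h
        obtain ⟨h | h, hne⟩ := h
        · exact ⟨n + 1, by rw [Function.iterate_succ_apply, h.parent_eq, hn]⟩
        · cases n with
          | zero =>
            exfalso
            simp only [Function.iterate_zero, id] at hn
            subst hn
            apply hne
            rw [← h.parent_eq, ← hpc.parent_eq]
            rfl
          | succ n => exact ⟨n, by rw [← hn, Function.iterate_succ_apply, h.parent_eq]⟩
    obtain ⟨n, hn⟩ := hq q ⟨0, rfl⟩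
    have h1 := depth_parent_iterate_le n p
    rw [hn, hpc.depth_eq] at h1
    omega
  rw [SimpleGraph.isAcyclic_iff_forall_adj_isBridge]
  rintro u v (h | h)
  · rw [Sym2.eq_swap]; exact key u v h
  · exact key v u h

/-- Every vertex has exactly `k + 1` neighbours. -/
theorem ncard_neighborSet {k : ℕ} (v : TreeVertex k) :
    ((regTree k).neighborSet v).ncard = k + 1 := by
  match v with
  | root =>
    have : (regTree k).neighborSet root = Set.range (fun i => node i []) := by
      ext u
      constructor
      · rintro (h | h)
        · cases h with | first i => exact ⟨i, rfl⟩
        · cases h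
      · rintro ⟨i, rfl⟩
        exact Or.inl (IsParent.first i)
    rw [this, ← Set.image_univ, Set.ncard_image_of_injective _ (fun i j h => by simpa using h)]
    simp
  | node i w =>
    have : (regTree k).neighborSet (node i w) =
        insert (node i w).parent (Set.range (fun a => node i (a :: w))) := by
      ext u
      constructor
      · rintro (h | h)
        · cases h with | later _ _ a => exact Or.inr ⟨a, rfl⟩
        · exact Or.inl h.parent_eq.symm
      · rintro (rfl | ⟨a, rfl⟩)
        · exact Or.inr (parent_isParent (by simp))
        · exact Or.inl (IsParent.later i w a)
    rw [this, Set.ncard_insert_of_notMem, ← Set.image_univ,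
      Set.ncard_image_of_injective _ (fun i j h => by simpa using h)]
    · simp
    · rintro ⟨a, ha⟩
      have h1 := congrArg depth ha
      have h2 := depth_parent_le (node i w)
      simp only [depth, List.length_cons] at h1 h2
      omega

end regTree

/-- The sphere of radius `j` around the root. -/
abbrev treeSphere (k j : ℕ) : Type :=
  {v : TreeVertex k // (regTree k).dist TreeVertex.root v = j}

theorem TreeVertex.finite_depth_eq (k j : ℕ) : {v : TreeVertex k | v.depth = j}.Finite := by
  match j with
  | 0 =>
    refine (Set.finite_singleton TreeVertex.root).subset ?_
    intro v hv
    match v, hv with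
    | TreeVertex.root, _ => rfl
  | j + 1 =>
    refine (((Set.finite_univ (α := Fin (k + 1))).prod
      (List.finite_length_eq (Fin k) j)).image
        (fun x => TreeVertex.node x.1 x.2)).subset ?_
    intro v hv
    match v, hv with
    | TreeVertex.node i w, hv =>
      exact ⟨(i, w), ⟨trivial, by simpa [TreeVertex.depth] using hv⟩, rfl⟩

instance treeSphere.finite (k j : ℕ) : Finite (treeSphere k j) := by
  have : {v : TreeVertex k | (regTree k).dist TreeVertex.root v = j}.Finite := by
    simpa only [regTree.dist_root] using TreeVertex.finite_depth_eq k j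
  exact this.to_subtype

noncomputable instance treeSphere.fintype (k j : ℕ) : Fintype (treeSphere k j) :=
  Fintype.ofFinite _

/-- Vertices of the tree carry the discrete topology. -/
instance TreeVertex.topologicalSpace (k : ℕ) : TopologicalSpace (TreeVertex k) := ⊥

instance TreeVertex.discreteTopology (k : ℕ) : DiscreteTopology (TreeVertex k) := ⟨rfl⟩

theorem TreeVertex.eventually_eq {k : ℕ} {X : Type*} [TopologicalSpace X] {f : X → TreeVertex k}
    (hf : Continuous f) (x : X) : ∀ᶠ z in nhds x, f z = f x :=
  ((isOpen_discrete {f x}).preimage hf).mem_nhds rfl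

/-- The topology of pointwise convergence on the group of automorphisms of the tree. -/
instance regTree.autTopology (k : ℕ) : TopologicalSpace (regTree k ≃g regTree k) :=
  TopologicalSpace.induced (fun x (v : TreeVertex k) => x v) inferInstance

theorem regTree.isInducing_apply (k : ℕ) :
    Topology.IsInducing (fun (x : regTree k ≃g regTree k) (v : TreeVertex k) => x v) := ⟨rfl⟩

theorem regTree.continuous_apply {k : ℕ} (v : TreeVertex k) :
    Continuous (fun x : regTree k ≃g regTree k => x v) :=
  (_root_.continuous_apply v).comp (regTree.isInducing_apply k).continuous

instance regTree.autIsTopologicalGroup (k : ℕ) :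
    IsTopologicalGroup (regTree k ≃g regTree k) where
  continuous_mul := by
    rw [(regTree.isInducing_apply k).continuous_iff]
    refine continuous_pi fun v => continuous_discrete_rng.mpr fun w => ?_
    rw [isOpen_iff_mem_nhds]
    rintro ⟨x, y⟩ h
    have h1 : ∀ᶠ z : (regTree k ≃g regTree k) × (regTree k ≃g regTree k) in nhds (x, y),
        z.2 v = y v :=
      TreeVertex.eventually_eq ((regTree.continuous_apply v).comp continuous_snd) (x, y)
    have h2 : ∀ᶠ z : (regTree k ≃g regTree k) × (regTree k ≃g regTree k) in nhds (x, y),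
        z.1 (y v) = x (y v) :=
      TreeVertex.eventually_eq ((regTree.continuous_apply (y v)).comp continuous_fst) (x, y)
    filter_upwards [h1, h2] with z hz1 hz2
    change z.1 (z.2 v) = w
    rw [hz1, hz2]
    exact h
  continuous_inv := by
    rw [(regTree.isInducing_apply k).continuous_iff]
    refine continuous_pi fun v => continuous_discrete_rng.mpr fun w => ?_
    have : (fun x : regTree k ≃g regTree k => x⁻¹ v) ⁻¹' {w} =
        (fun x : regTree k ≃g regTree k => x w) ⁻¹' {v} := by
      ext x
      change x.symm v = w ↔ x w = v
      exact ⟨fun h => h ▸ x.apply_symm_apply v, fun h => h ▸ x.symm_apply_apply w⟩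
    change IsOpen ((fun x : regTree k ≃g regTree k => x⁻¹ v) ⁻¹' {w})
    rw [this]
    exact (isOpen_discrete _).preimage (regTree.continuous_apply w)

/-- The group of automorphisms of the tree that fix the root. -/
def rootedAut (k : ℕ) : Subgroup (regTree k ≃g regTree k) where
  carrier := {x | x TreeVertex.root = TreeVertex.root}
  one_mem' := rfl
  mul_mem' {x y} hx hy := by
    change x (y TreeVertex.root) = TreeVertex.root
    rw [show y TreeVertex.root = TreeVertex.root from hy]
    exact hx
  inv_mem' {x} hx := by
    change x.symm TreeVertex.root = TreeVertex.root
    rw [RelIso.symm_apply_eq]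
    exact (show x TreeVertex.root = TreeVertex.root from hx).symm

theorem rootedAut.dist_apply {k : ℕ} (x : rootedAut k) (v : TreeVertex k) :
    (regTree k).dist TreeVertex.root (x.1 v) = (regTree k).dist TreeVertex.root v := by
  have h : ∀ (y : rootedAut k) (u : TreeVertex k),
      (regTree k).dist TreeVertex.root (y.1 u) ≤ (regTree k).dist TreeVertex.root u := by
    intro y u
    obtain ⟨p, hp⟩ := (regTree.connected k).exists_walk_length_eq_dist TreeVertex.root u
    have h1 := SimpleGraph.dist_le (p.map y.1.toHom)
    rw [SimpleGraph.Walk.length_map, hp] at h1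
    have h2 : y.1.toHom TreeVertex.root = TreeVertex.root := y.2
    rw [h2] at h1
    exact h1
  refine le_antisymm (h x v) ?_
  have := h x⁻¹ (x.1 v)
  have e : (x⁻¹).1 (x.1 v) = v := x.1.symm_apply_apply v
  rwa [e] at this

/-- The action of root-fixing automorphisms on the sphere of radius `j`. -/
def sphereAction (k j : ℕ) : rootedAut k →* Equiv.Perm (treeSphere k j) where
  toFun x := Equiv.Perm.subtypePerm x.1.toEquiv (fun v => by
    change (regTree k).dist TreeVertex.root (x.1 v) = j ↔ _
    rw [rootedAut.dist_apply])
  map_one' := rfl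
  map_mul' _ _ := rfl

/-- The group of positive automorphisms: those inducing an even permutation of every sphere. -/
noncomputable def positiveAut (k : ℕ) : Subgroup (rootedAut k) :=
  ⨅ (j : ℕ) (_ : 1 ≤ j), (Equiv.Perm.sign.comp (sphereAction k j)).ker

instance rootedAut.compactSpace (k : ℕ) : CompactSpace (rootedAut k) := by
  let φ : rootedAut k → (TreeVertex k → TreeVertex k) × (TreeVertex k → TreeVertex k) :=
    fun x => (fun v => x.1 v, fun v => x.1⁻¹ v)
  have hind : Topology.IsInducing fun x : rootedAut k => fun v => x.1 v :=
    (regTree.isInducing_apply k).comp Topology.IsInducing.subtypeVal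
  have hφc : Continuous φ :=
    hind.continuous.prodMk
      ((regTree.isInducing_apply k).continuous.comp (continuous_subtype_val.inv))
  have hφ : Topology.IsInducing φ :=
    Topology.IsInducing.of_comp hφc continuous_fst hind
  rw [← isCompact_univ_iff, hφ.isCompact_iff, Set.image_univ]
  let B : Set (TreeVertex k → TreeVertex k) :=
    Set.pi Set.univ fun v => {w | w.depth = v.depth}
  have hB : IsCompact B := by
    exact isCompact_univ_pi fun v => (TreeVertex.finite_depth_eq k v.depth).isCompact
  refine (hB.prod hB).of_isClosed_subset ?_ ?_
  · have hr : Set.range φ =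
        {q | (∀ v, q.2 (q.1 v) = v) ∧ (∀ v, q.1 (q.2 v) = v) ∧
          (∀ u v, (regTree k).Adj (q.1 u) (q.1 v) ↔ (regTree k).Adj u v) ∧
          q.1 TreeVertex.root = TreeVertex.root} := by
      ext q
      constructor
      · rintro ⟨x, rfl⟩
        exact ⟨fun v => x.1.symm_apply_apply v, fun v => x.1.apply_symm_apply v,
          fun u v => x.1.map_rel_iff, x.2⟩
      · rintro ⟨h1, h2, h3, h4⟩
        exact ⟨⟨⟨⟨q.1, q.2, h1, h2⟩, fun {u v} => h3 u v⟩, h4⟩, rfl⟩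
    have ev : ∀ (a b : TreeVertex k → TreeVertex k) (v : TreeVertex k),
        ∀ᶠ q in nhds (a, b), q.1 v = a v := fun a b v =>
      TreeVertex.eventually_eq ((_root_.continuous_apply v).comp continuous_fst) (a, b)
    have ev' : ∀ (a b : TreeVertex k → TreeVertex k) (v : TreeVertex k),
        ∀ᶠ q in nhds (a, b), q.2 v = b v := fun a b v =>
      TreeVertex.eventually_eq ((_root_.continuous_apply v).comp continuous_snd) (a, b)
    rw [← isOpen_compl_iff, isOpen_iff_mem_nhds, hr]
    rintro ⟨a, b⟩ hab
    simp only [Set.mem_compl_iff, Set.mem_ofPred_eq, not_and_or, not_forall] at hab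
    rcases hab with ⟨v, h⟩ | ⟨v, h⟩ | ⟨u, v, h⟩ | h
    · filter_upwards [ev a b v, ev' a b (a v)] with q e1 e2 hq
      exact h (by rw [← e2, ← e1]; exact hq.1 v)
    · filter_upwards [ev' a b v, ev a b (b v)] with q e1 e2 hq
      exact h (by rw [← e2, ← e1]; exact hq.2.1 v)
    · filter_upwards [ev a b u, ev a b v] with q e1 e2 hq
      exact h (by rw [← e2, ← e1]; exact hq.2.2.1 u v)
    · filter_upwards [ev a b TreeVertex.root] with q e1 hq
      exact h (e1 ▸ hq.2.2.2)
  · rintro _ ⟨x, rfl⟩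
    refine ⟨fun v _ => ?_, fun v _ => ?_⟩
    · have h := rootedAut.dist_apply x v
      rwa [regTree.dist_root, regTree.dist_root] at h
    · have h := rootedAut.dist_apply x⁻¹ v
      rwa [regTree.dist_root, regTree.dist_root] at h

theorem isClosed_positiveAut (k : ℕ) : IsClosed (positiveAut k : Set (rootedAut k)) := by
  simp only [positiveAut, Subgroup.coe_iInf]
  refine isClosed_iInter fun j => isClosed_iInter fun _ => ?_
  rw [← isOpen_compl_iff, isOpen_iff_mem_nhds]
  intro x hx
  have hev : ∀ᶠ y : rootedAut k in nhds x, ∀ v : treeSphere k j, y.1 v.1 = x.1 v.1 := by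
    rw [Filter.eventually_all]
    intro v
    exact TreeVertex.eventually_eq
      ((regTree.continuous_apply v.1).comp continuous_subtype_val) x
  filter_upwards [hev] with y hy hmem
  apply hx
  have e : sphereAction k j y = sphereAction k j x :=
    Equiv.ext fun v => Subtype.ext (hy v)
  have hmem' : Equiv.Perm.sign (sphereAction k j y) = 1 := hmem
  change Equiv.Perm.sign (sphereAction k j x) = 1
  rw [← e]
  exact hmem'

instance positiveAut.compactSpace (k : ℕ) : CompactSpace (positiveAut k) :=
  isCompact_iff_compactSpace.mp (isClosed_positiveAut k).isCompact

/-- The group of positive automorphisms carries its Borel sigma-algebra. -/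
instance positiveAut.measurableSpace (k : ℕ) : MeasurableSpace (positiveAut k) := borel _

instance positiveAut.borelSpace (k : ℕ) : BorelSpace (positiveAut k) := ⟨rfl⟩

/-- The Haar measure of a compact group, normalized to total mass one. -/
noncomputable def normalizedHaar (G : Type*) [Group G] [TopologicalSpace G] [IsTopologicalGroup G]
    [CompactSpace G] [MeasurableSpace G] [BorelSpace G] : MeasureTheory.Measure G :=
  MeasureTheory.Measure.haarMeasure (⊤ : TopologicalSpace.PositiveCompacts G)

/-- The product-free measure of a compact group: the supremum of the normalized Haar measures of
its measurable product-free subsets. -/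
noncomputable def productFreeMeasure (G : Type*) [Group G] [TopologicalSpace G]
    [IsTopologicalGroup G] [CompactSpace G] [MeasurableSpace G] [BorelSpace G] : ℝ :=
  sSup {r : ℝ | ∃ A : Set G, MeasurableSet A ∧ A ∩ (A * A) = ∅ ∧ r = (normalizedHaar G).real A}

/-!
The representation bound is proved first, and it gives the upper bound for the product-free measure.

*Alternating groups.* A representation of the alternating group of degree `n ≥ 7` of dimension at
most `n - 3` is trivial (`alternatingGroup_representation_eq_one`). If it is not, a 3-cycle `c` has
an eigenvector `v` whose eigenvalue is a non-trivial cube root of unity. The even permutations of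
the other `n - 3` points fix `v`: for `n ≥ 10` by induction, since the eigenspace of `c` has at most
half the dimension; for `n ≤ 9` by counting the joint eigenvalues of two disjoint 3-cycles, which
would have to be eight different pairs (`threeCycle₂_fixes_eigenvector`). Then `v` has only `n - 2`
translates under the even permutations fixing two of the points of `c`, and every linear relation
between them is a multiple of their sum; so they span a space of dimension at least `n - 3`, that
is, everything, and this leaves no room for the eigenvector of `c` with the inverse eigenvalue
(`eigenvector_eq_zero_of_fixed`).

*Positive automorphisms.* A closed normal subgroup that contains the even permutations of the
`k + 1` branches at the root is the whole group (`eq_top_of_evenRootPerm_mem`). Modulo such a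
subgroup, what an automorphism does to the children of one vertex can be moved to any other vertex
of the same level. The permutations of children at two different vertices commute, so the even ones
at one vertex, being products of commutators, belong to the subgroup; and a product of two equal
transpositions at two vertices of one level belongs to it as well. Hence so does every positive
automorphism that only permutes the children of the vertices of one level, and by correcting level
after level the subgroup is dense. A continuous representation of degree less than `k - 1` is
trivial on the even permutations of the `k + 1` branches by the bound for the alternating group of
degree `k + 1`; its kernel is therefore everything (`positiveAut_representation_eq_one`).

*Upper bound.* In a finite group whose non-trivial representations have dimension at least `D`,
Gowers' argument bounds the density of product-free sets by `D ^ (-1/3)` (`card_pow_three_mul_le`):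
the matrix `1_B (x⁻¹ z)` less its mean has small operator norm, because its top singular value has
multiplicity at least `D`. A measurable product-free subset of a profinite group is approximated by
a union of cosets of an open normal subgroup, which is still product-free in the quotient if the
cosets that are filled by more than half are taken (`measureReal_le_of_productFree`).

*Lower bound.* The positive automorphisms taking one fixed child of the root to another fixed child
form a product-free set of measure `1 / (k + 1)` (`exists_productFree_measureReal_eq`).
-/

/-! ### Operators of order three -/

section CubeRoots

variable {V : Type*} [AddCommGroup V] [Module ℂ V]

theorem cube_root_sum {ω : ℂ} (h3 : ω ^ 3 = 1) (h1 : ω ≠ 1) : ω ^ 2 + ω + 1 = 0 := by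
  have : (ω - 1) * (ω ^ 2 + ω + 1) = 0 := by linear_combination h3
  exact (mul_eq_zero.mp this).resolve_left (sub_ne_zero.mpr h1)

theorem cube_root_eq_or {ω η : ℂ} (h3 : ω ^ 3 = 1) (h1 : ω ≠ 1) (e3 : η ^ 3 = 1) (e1 : η ≠ 1) :
    η = ω ∨ η = ω ^ 2 := by
  have hs := cube_root_sum h3 h1
  have he := cube_root_sum e3 e1
  have : (η - ω) * (η - ω ^ 2) = 0 := by linear_combination he - η * hs + h3
  rcases mul_eq_zero.mp this with h | h
  · exact Or.inl (sub_eq_zero.mp h)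
  · exact Or.inr (sub_eq_zero.mp h)

theorem cube_root_sq {ω : ℂ} (h3 : ω ^ 3 = 1) (h1 : ω ≠ 1) :
    (ω ^ 2) ^ 3 = 1 ∧ ω ^ 2 ≠ 1 ∧ ω ^ 2 ≠ ω := by
  have h0 : ω ≠ 0 := by rintro rfl; norm_num at h3
  refine ⟨by linear_combination (ω ^ 3 + 1) * h3, fun h => h1 ?_, fun h => h1 ?_⟩
  · linear_combination h3 - ω * h
  · apply mul_left_cancel₀ h0; linear_combination h

/-- If `b ^ 3 = 1` moves `v`, then some polynomial in `b` takes `v` to an eigenvector of `b` for a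
nontrivial cube root of unity; being a polynomial in `b`, it keeps the eigenvector equations of `v`
for the operators commuting with `b`. -/
theorem exists_eigenvector_of_cube {b : Module.End ℂ V} (hb : b ^ 3 = 1) {v : V} (hv : b v ≠ v) :
    ∃ (u : V) (η : ℂ), u ≠ 0 ∧ η ^ 3 = 1 ∧ η ≠ 1 ∧ b u = η • u ∧
      ∀ (a : Module.End ℂ V) (s : ℂ), Commute a b → a v = s • v → a u = s • u := by
  obtain ⟨ω, hω⟩ : ∃ ω : ℂ, IsPrimitiveRoot ω 3 := ⟨_, Complex.isPrimitiveRoot_exp 3 (by norm_num)⟩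
  have h3 := hω.pow_eq_one
  have h1 : ω ≠ 1 := hω.ne_one (by norm_num)
  have hs := cube_root_sum h3 h1
  have hb' : ∀ x, b (b (b x)) = x := fun x => by
    have := congrArg (fun f : Module.End ℂ V => f x) hb
    simpa [pow_succ] using this
  have hcomm : ∀ (a : Module.End ℂ V), Commute a b → ∀ x, a (b x) = b (a x) := fun a h x =>
    congrArg (fun f : Module.End ℂ V => f x) h
  by_cases h : b (b v - v) = ω • (b v - v)
  · refine ⟨b v - v, ω, sub_ne_zero.mpr hv, h3, h1, h, fun a s ha hav => ?_⟩
    rw [map_sub, hcomm a ha, hav, map_smul, smul_sub]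
  · refine ⟨b (b v - v) - ω • (b v - v), ω ^ 2, sub_ne_zero.mpr h, (cube_root_sq h3 h1).1,
      (cube_root_sq h3 h1).2.1, ?_, fun a s ha hav => ?_⟩
    · simp only [map_sub, map_smul, hb', smul_sub, smul_smul]
      have e : ω ^ 2 = -1 - ω := by linear_combination hs
      have e2 : ω ^ 2 * ω = 1 := by linear_combination h3
      rw [e2, e]
      module
    · simp only [map_sub, map_smul, hcomm a ha, hav, smul_sub]
      simp only [smul_comm s ω]

/-- Two commuting operators having a common eigenvector for each pair of cube roots of unity other
than `(1, 1)` act on a space of dimension at least `8`. -/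
theorem eight_le_finrank [FiniteDimensional ℂ V] {a b : Module.End ℂ V} (hab : Commute a b)
    {ω : ℂ} (h3 : ω ^ 3 = 1) (h1 : ω ≠ 1)
    (h : ∀ s t : ℂ, s ^ 3 = 1 → t ^ 3 = 1 → (s, t) ≠ (1, 1) →
      ∃ v : V, v ≠ 0 ∧ a v = s • v ∧ b v = t • v) : 8 ≤ Module.finrank ℂ V := by
  classical
  let f : Fin 2 → Module.End ℂ V := ![a, b]
  have hind : iSupIndep fun χ : Fin 2 → ℂ => ⨅ i, (f i).maxGenEigenspace (χ i) := by
    apply Module.End.independent_iInf_maxGenEigenspace_of_forall_mapsTo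
    intro i j φ
    apply Module.End.mapsTo_maxGenEigenspace_of_comm
    fin_cases i <;> fin_cases j
    · exact Commute.refl a
    · exact hab.symm
    · exact hab
    · exact Commute.refl b
  let r : Fin 3 → ℂ := fun i => ω ^ (i : ℕ)
  have hr : Function.Injective r := by
    obtain ⟨-, h21, h2⟩ := cube_root_sq h3 h1
    have r0 : r 0 = 1 := pow_zero ω
    have r1 : r 1 = ω := pow_one ω
    have r2 : r 2 = ω ^ 2 := rfl
    have n01 : r 0 ≠ r 1 := by rw [r0, r1]; exact h1.symm
    have n02 : r 0 ≠ r 2 := by rw [r0, r2]; exact h21.symm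
    have n12 : r 1 ≠ r 2 := by rw [r1, r2]; exact h2.symm
    intro i j hij
    fin_cases i <;> fin_cases j <;>
      first
        | rfl
        | exact absurd hij n01
        | exact absurd hij n02
        | exact absurd hij n12
        | exact absurd hij.symm n01
        | exact absurd hij.symm n02
        | exact absurd hij.symm n12
  have hr3 : ∀ i, r i ^ 3 = 1 := fun i => by
    simp only [r]; rw [← pow_mul, mul_comm, pow_mul, h3, one_pow]
  let ι := {p : Fin 3 × Fin 3 // p ≠ (0, 0)}
  let χ : ι → (Fin 2 → ℂ) := fun p => ![r p.1.1, r p.1.2]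
  have hχ : Function.Injective χ := by
    intro p q hpq
    have e0 := congrFun hpq 0
    have e1 := congrFun hpq 1
    exact Subtype.ext (Prod.ext (hr e0) (hr e1))
  have hind' := hind.comp hχ
  have hne : ∀ p : ι, (⨅ i, (f i).maxGenEigenspace (χ p i)) ≠ ⊥ := by
    intro p
    obtain ⟨v, hv, hav, hbv⟩ := h (r p.1.1) (r p.1.2) (hr3 _) (hr3 _) (by
      intro hc
      apply p.2
      have h0 : r 0 = 1 := by simp [r]
      rw [Prod.mk.injEq, ← h0] at hc
      exact Prod.ext (hr hc.1) (hr hc.2))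
    rw [Submodule.ne_bot_iff]
    refine ⟨v, ?_, hv⟩
    rw [Submodule.mem_iInf]
    intro i
    refine (Module.End.mem_maxGenEigenspace _ _ _).mpr ⟨1, ?_⟩
    rw [pow_one, LinearMap.sub_apply, sub_eq_zero]
    fin_cases i
    · exact hav
    · exact hbv
  have := hind'.subtype_ne_bot_le_finrank
  have hcard : Fintype.card {i // ((fun χ : Fin 2 → ℂ => ⨅ i, (f i).maxGenEigenspace (χ i)) ∘ χ) i ≠ ⊥}
      = Fintype.card ι := Fintype.card_congr (Equiv.subtypeUnivEquiv hne)
  have h8 : Fintype.card ι = 8 := by decide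
  omega

end CubeRoots

/-! ### Alternating groups of subsets -/

section Embedding

open Equiv

/-- The homomorphism of alternating groups induced by an embedding of the underlying sets. -/
noncomputable def altEmb {β α : Type*} [Fintype β] [DecidableEq β] [Fintype α] [DecidableEq α]
    (f : β ↪ α) : alternatingGroup β →* alternatingGroup α :=
  ((Perm.viaEmbeddingHom f).comp (alternatingGroup β).subtype).codRestrict (alternatingGroup α)
    fun g => by
      have hg := g.2
      rw [Perm.mem_alternatingGroup] at hg ⊢
      have e : Perm.viaEmbedding g.1 f = Perm.viaFintypeEmbedding g.1 f := by
        ext y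
        by_cases hy : y ∈ Set.range f
        · obtain ⟨x, rfl⟩ := hy
          rw [Perm.viaEmbedding_apply, Perm.viaFintypeEmbedding_apply_image]
        · rw [Perm.viaEmbedding_apply_of_notMem _ _ _ hy,
            Perm.viaFintypeEmbedding_apply_notMem_range _ _ hy]
      change Perm.sign (Perm.viaEmbedding g.1 f) = 1
      rw [e, Perm.viaFintypeEmbedding_sign, hg]

variable {β α : Type*} [Fintype β] [DecidableEq β] [Fintype α] [DecidableEq α]

theorem altEmb_apply (f : β ↪ α) (g : alternatingGroup β) (x : β) :
    (altEmb f g).1 (f x) = f (g.1 x) :=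
  Perm.viaEmbedding_apply g.1 f x

theorem altEmb_apply_of_notMem (f : β ↪ α) (g : alternatingGroup β) {x : α}
    (hx : x ∉ Set.range f) : (altEmb f g).1 x = x :=
  Perm.viaEmbedding_apply_of_notMem g.1 f x hx

/-- Moving the embedding by a permutation conjugates the induced homomorphism. -/
theorem coe_altEmb_trans (f : β ↪ α) (π : Perm α) (g : alternatingGroup β) :
    (altEmb (f.trans π.toEmbedding) g).1 = π * (altEmb f g).1 * π⁻¹ := by
  ext y
  obtain ⟨x, rfl⟩ := π.surjective y
  rw [Perm.mul_apply, Perm.mul_apply, Perm.inv_def, Equiv.symm_apply_apply]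
  by_cases hx : x ∈ Set.range f
  · obtain ⟨z, rfl⟩ := hx
    rw [altEmb_apply]
    exact altEmb_apply (f.trans π.toEmbedding) g z
  · rw [altEmb_apply_of_notMem f g hx]
    apply altEmb_apply_of_notMem
    rintro ⟨z, hz⟩
    exact hx ⟨z, π.injective hz⟩

end Embedding

/-! ### The alternating group of degree seven -/

section AltSeven

open Equiv

theorem swap_mul_swap_mem_alternatingGroup {α : Type*} [Fintype α] [DecidableEq α] {a b c d : α}
    (h : a ≠ b) (h' : c ≠ d) : swap a b * swap c d ∈ alternatingGroup α :=
  Perm.mul_mem_alternatingGroup_of_isSwap ⟨a, b, h, rfl⟩ ⟨c, d, h', rfl⟩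

theorem four_swap_mem_alternatingGroup {α : Type*} [Fintype α] [DecidableEq α]
    {a b c d a' b' c' d' : α} (h₁ : a ≠ b) (h₂ : c ≠ d) (h₃ : a' ≠ b') (h₄ : c' ≠ d') :
    swap a b * swap c d * swap a' b' * swap c' d' ∈ alternatingGroup α := by
  rw [mul_assoc _ (swap a' b')]
  exact mul_mem (swap_mul_swap_mem_alternatingGroup h₁ h₂)
    (swap_mul_swap_mem_alternatingGroup h₃ h₄)

/-- The 3-cycle `(0 1 2)` in the alternating group of degree seven. -/
def threeCycle₁ : alternatingGroup (Fin 7) := ⟨swap 0 1 * swap 1 2,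
      swap_mul_swap_mem_alternatingGroup (by decide) (by decide)⟩

/-- The 3-cycle `(3 4 5)` in the alternating group of degree seven. -/
def threeCycle₂ : alternatingGroup (Fin 7) := ⟨swap 3 4 * swap 4 5,
      swap_mul_swap_mem_alternatingGroup (by decide) (by decide)⟩

theorem threeCycle₁_pow_three : threeCycle₁ ^ 3 = 1 := by decide

theorem threeCycle₂_pow_three : threeCycle₂ ^ 3 = 1 := by decide

theorem commute_threeCycle : Commute threeCycle₁ threeCycle₂ := by
  change threeCycle₁ * threeCycle₂ = threeCycle₂ * threeCycle₁
  decide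

variable {V : Type*} [AddCommGroup V] [Module ℂ V]

theorem eq_one_of_map_eq_one {α : Type*} [Fintype α] [DecidableEq α] (h5 : 5 ≤ Fintype.card α)
    {M : Type*} [Monoid M] (σ : alternatingGroup α →* M) {g : alternatingGroup α} (hg : g ≠ 1)
    (h : σ g = 1) : σ = 1 := by
  have : IsSimpleGroup (alternatingGroup α) := alternatingGroup.isSimpleGroup (by simpa using h5)
  rcases (inferInstance : σ.ker.Normal).eq_bot_or_eq_top with hk | hk
  · exact absurd ((Subgroup.mem_bot).mp (hk ▸ (MonoidHom.mem_ker.mpr h))) hg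
  · ext x
    exact MonoidHom.mem_ker.mp (hk ▸ Subgroup.mem_top x)

theorem map_mul_apply' {G : Type*} [Group G] (σ : G →* Module.End ℂ V) (g h : G) (v : V) :
    σ (g * h) v = σ g (σ h v) := by rw [map_mul]; rfl

/-- If the vectors fixed by a 3-cycle are fixed by the Klein four-group it normalizes,
then the representation is trivial. -/
theorem eq_one_of_fixed_imp_fixed (σ : alternatingGroup (Fin 7) →* Module.End ℂ V)
    (h : ∀ v, σ threeCycle₁ v = v →
      σ ⟨swap 0 1 * swap 2 3,
      swap_mul_swap_mem_alternatingGroup (by decide) (by decide)⟩ v = v ∧ σ ⟨swap 0 2 * swap 1 3,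
      swap_mul_swap_mem_alternatingGroup (by decide) (by decide)⟩ v = v) :
    σ = 1 := by
  set k₁ : alternatingGroup (Fin 7) := ⟨swap 0 1 * swap 2 3,
      swap_mul_swap_mem_alternatingGroup (by decide) (by decide)⟩ with hk₁
  set k₂ : alternatingGroup (Fin 7) := ⟨swap 0 2 * swap 1 3,
      swap_mul_swap_mem_alternatingGroup (by decide) (by decide)⟩ with hk₂
  set c := threeCycle₁
  have hc3 : ∀ v, σ c (σ c (σ c v)) = v := fun v => by
    rw [← map_mul_apply', ← map_mul_apply', show c * c * c = 1 by decide, map_one]; rfl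
  -- a vector on which `k₁` acts by `1` and `k₂` by `-1` vanishes
  have key : ∀ y, σ k₁ y = y → σ k₂ y = -y → y = 0 := by
    intro y h1 h2
    have hz := h (y + σ c y + σ c (σ c y)) (by
      rw [map_add, map_add, hc3]; abel)
    have b1 : σ k₂ (σ c y) = -σ c y := by
      rw [← map_mul_apply', show k₂ * c = c * (k₁ * k₂) by decide, map_mul_apply', map_mul_apply',
        h2, map_neg, h1, map_neg]
    have b2 : σ k₂ (σ c (σ c y)) = σ c (σ c y) := by
      rw [← map_mul_apply', ← map_mul_apply', show k₂ * c * c = c * c * k₁ by decide,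
        map_mul_apply', map_mul_apply', h1]
    have e2 := hz.2
    rw [map_add, map_add, h2, b1, b2] at e2
    have f1 : σ c y = -y := by
      have : (2 : ℂ) • (y + σ c y) = 0 := by
        rw [← sub_eq_zero] at e2
        rw [← neg_eq_zero, ← e2]; module
      rw [smul_eq_zero] at this
      exact (neg_eq_of_add_eq_zero_right (this.resolve_left two_ne_zero)).symm
    have f2 := hc3 y
    simp only [f1, map_neg, neg_neg] at f2
    have : (2 : ℂ) • y = 0 := by
      rw [two_smul]; nth_rewrite 1 [← f2]; simp
    exact (smul_eq_zero.mp this).resolve_left two_ne_zero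
  have hk1 : ∀ v, σ k₁ (σ k₁ v) = v := fun v => by
    rw [← map_mul_apply', show k₁ * k₁ = 1 by decide, map_one]; rfl
  have hk2 : ∀ v, σ k₂ (σ k₂ v) = v := fun v => by
    rw [← map_mul_apply', show k₂ * k₂ = 1 by decide, map_one]; rfl
  have hk12 : ∀ v, σ k₁ (σ k₂ v) = σ k₂ (σ k₁ v) := fun v => by
    rw [← map_mul_apply', show k₁ * k₂ = k₂ * k₁ by decide, map_mul_apply']
  -- hence so does every vector on which `k₂` acts by `-1`
  have hE : ∀ v, (v - σ k₂ v) + σ k₁ (v - σ k₂ v) = 0 := by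
    intro v
    apply key
    · simp only [map_add, map_sub, hk1]; abel
    · simp only [map_add, map_sub, hk2, ← hk12]; abel
  apply eq_one_of_map_eq_one (by simp) σ (g := k₂) (by decide)
  ext v
  have e1 := hE v
  have e2 : σ (k₁ * k₂) v = σ c (σ k₁ (σ c (σ c v))) := by
    rw [← map_mul_apply', ← map_mul_apply', ← map_mul_apply',
      show k₁ * k₂ = c * (k₁ * (c * c)) by decide, mul_assoc, mul_assoc]
  have e3 : σ k₁ v = σ c (σ k₂ (σ c (σ c v))) := by
    rw [← map_mul_apply', ← map_mul_apply', ← map_mul_apply',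
      show c * k₂ * c * c = k₁ by decide]
  have e4 : σ k₂ v = σ c (σ (k₁ * k₂) (σ c (σ c v))) := by
    rw [← map_mul_apply', ← map_mul_apply', ← map_mul_apply',
      show c * (k₁ * k₂) * c * c = k₂ by decide]
  have e5 := congrArg (σ c) (hE (σ c (σ c v)))
  simp only [map_sub, map_add, map_zero, ← map_mul_apply' σ k₁ k₂] at e5 e1
  rw [← e2, ← e3, ← e4, hc3] at e5
  have : (2 : ℂ) • (v - σ k₂ v) = 0 := by
    rw [show (0 : V) = 0 + 0 by simp]
    nth_rewrite 1 [← e1]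
    rw [← e5]
    module
  exact (sub_eq_zero.mp ((smul_eq_zero.mp this).resolve_left two_ne_zero)).symm

/-- In a representation of dimension at most seven of the alternating group of degree seven, two
disjoint 3-cycles have no common eigenvector with both eigenvalues different from `1`. -/
theorem threeCycle₂_fixes_eigenvector [FiniteDimensional ℂ V] (hV : Module.finrank ℂ V ≤ 7)
    (σ : alternatingGroup (Fin 7) →* Module.End ℂ V) {ω : ℂ} (h3 : ω ^ 3 = 1) (h1 : ω ≠ 1)
    {v : V} (hv : σ threeCycle₁ v = ω • v) : σ threeCycle₂ v = v := by
  set c := threeCycle₁ with hc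
  set c' := threeCycle₂ with hc'
  have hab : Commute (σ c) (σ c') := commute_threeCycle.map σ
  have hb3 : σ c' ^ 3 = 1 := by rw [← map_pow, threeCycle₂_pow_three, map_one]
  by_contra hne
  -- `r` permutes cyclically the pairs `c`, `c'`, `c⁻¹`, `c'⁻¹`
  let r : alternatingGroup (Fin 7) := ⟨swap 0 3 * swap 3 1 * swap 1 4 * swap 2 5,
      four_swap_mem_alternatingGroup (by decide) (by decide) (by decide) (by decide)⟩
  have hr : ∀ (u : V) (s t : ℂ), t ^ 3 = 1 → u ≠ 0 → σ c u = s • u → σ c' u = t • u →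
      σ r u ≠ 0 ∧ σ c (σ r u) = t ^ 2 • σ r u ∧ σ c' (σ r u) = s • σ r u := by
    intro u s t ht hu hs ht'
    refine ⟨fun h0 => hu ?_, ?_, ?_⟩
    · have := congrArg (σ r⁻¹) h0
      rwa [← map_mul_apply', inv_mul_cancel, map_one, map_zero] at this
    · rw [← map_mul_apply', show c * r = r * (c' * c') by decide, map_mul_apply', map_mul_apply',
        ht', map_smul, ht', smul_smul, map_smul, sq]
    · rw [← map_mul_apply', show c' * r = r * c by decide, map_mul_apply', hs, map_smul]
  let W : ℂ → ℂ → Prop := fun s t => ∃ u : V, u ≠ 0 ∧ σ c u = s • u ∧ σ c' u = t • u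
  have hW : ∀ s t, t ^ 3 = 1 → W s t → W (t ^ 2) s := by
    rintro s t ht ⟨u, hu, hs, ht'⟩
    exact ⟨σ r u, hr u s t ht hu hs ht'⟩
  obtain ⟨u, η, hu, he3, he1, hbu, hau⟩ := exists_eigenvector_of_cube hb3 hne
  obtain ⟨g3, g1, g2⟩ := cube_root_sq h3 h1
  have g4 : (ω ^ 2) ^ 2 = ω := by linear_combination ω * h3
  -- all four pairs of nontrivial cube roots of unity occur
  have hall : ∀ s t, (s = ω ∨ s = ω ^ 2) → (t = ω ∨ t = ω ^ 2) → W s t := by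
    have w1 : W ω η := ⟨u, hu, hau _ ω hab hv, hbu⟩
    have w2 := hW _ _ he3 w1
    have w3 := hW _ _ h3 w2
    have w4 := hW _ _ (by rw [← pow_mul, mul_comm, pow_mul, he3, one_pow]) w3
    rcases cube_root_eq_or h3 h1 he3 he1 with rfl | rfl
    · rw [g4] at w4
      rintro s t (rfl | rfl) (rfl | rfl) <;> assumption
    · simp only [g4] at w2 w3 w4
      rintro s t (rfl | rfl) (rfl | rfl) <;> assumption
  have hfix : ∀ x, σ c x = x → σ c' x = x := by
    intro x hx
    by_contra hxne
    obtain ⟨y, ζ, hy, hz3, hz1, hby, hay⟩ := exists_eigenvector_of_cube hb3 hxne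
    have w1 : W 1 ζ := ⟨y, hy, hay _ 1 hab (by simpa using hx), hby⟩
    have w2 := hW _ _ hz3 w1
    have w3 := hW _ _ (one_pow 3) w2
    have w4 := hW _ _ (by rw [← pow_mul, mul_comm, pow_mul, hz3, one_pow]) w3
    rw [one_pow] at w3 w4
    have hall' : ∀ s, (s = ω ∨ s = ω ^ 2) → W s 1 ∧ W 1 s := by
      rcases cube_root_eq_or h3 h1 hz3 hz1 with rfl | rfl
      · rw [g4] at w4
        rintro s (rfl | rfl) <;> constructor <;> assumption
      · simp only [g4] at w2 w3 w4
        rintro s (rfl | rfl) <;> constructor <;> assumption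
    have := eight_le_finrank hab h3 h1 (fun s t hs ht hst => by
      by_cases hs1 : s = 1
      · by_cases ht1 : t = 1
        · exact absurd (by rw [hs1, ht1]) hst
        · rw [hs1]
          exact (hall' t (cube_root_eq_or h3 h1 ht ht1)).2
      · by_cases ht1 : t = 1
        · rw [ht1]
          exact (hall' s (cube_root_eq_or h3 h1 hs hs1)).1
        · exact hall s t (cube_root_eq_or h3 h1 hs hs1) (cube_root_eq_or h3 h1 ht ht1))
    omega
  have hconj : ∀ (g : alternatingGroup (Fin 7)) (x : V), σ (g * c * g⁻¹) x = x →
      σ (g * c' * g⁻¹) x = x := by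
    intro g x hx
    have e : σ c (σ g⁻¹ x) = σ g⁻¹ x := by
      nth_rewrite 2 [← hx]
      rw [← map_mul_apply', ← map_mul_apply']
      congr 2
      group
    rw [mul_assoc, map_mul_apply', map_mul_apply', hfix _ e, ← map_mul_apply', mul_inv_cancel,
      map_one]
    rfl
  -- conjugates of the pair `c`, `c'` lead from `(0 1 2)` to `(4 5 6)` and on to `(1 0 3)`
  let e : alternatingGroup (Fin 7) := ⟨swap 4 5 * swap 5 6,
    swap_mul_swap_mem_alternatingGroup (by decide) (by decide)⟩
  let d : alternatingGroup (Fin 7) := ⟨swap 1 0 * swap 0 3,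
    swap_mul_swap_mem_alternatingGroup (by decide) (by decide)⟩
  let g : alternatingGroup (Fin 7) := ⟨swap 3 4 * swap 4 5 * swap 5 6 * swap 0 1,
    four_swap_mem_alternatingGroup (by decide) (by decide) (by decide) (by decide)⟩
  let g' : alternatingGroup (Fin 7) := ⟨swap 0 4 * swap 1 5 * swap 5 3 * swap 2 6,
    four_swap_mem_alternatingGroup (by decide) (by decide) (by decide) (by decide)⟩
  have hone : σ = 1 := by
    apply eq_one_of_fixed_imp_fixed
    intro x (hx : σ c x = x)
    have hx1 : σ e x = x := by
      have := hconj g x (by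
        rw [show g * c * g⁻¹ = c * c by decide, map_mul_apply', hx, hx])
      rwa [show g * c' * g⁻¹ = e by decide] at this
    have hx2 : σ d x = x := by
      have := hconj g' x (by rwa [show g' * c * g'⁻¹ = e by decide])
      rwa [show g' * c' * g'⁻¹ = d by decide] at this
    refine ⟨?_, ?_⟩
    · have : σ (c * c * d * d * c * c) x = x := by simp only [map_mul_apply', hx, hx2]
      rwa [show c * c * d * d * c * c = ⟨swap 0 1 * swap 2 3,
        swap_mul_swap_mem_alternatingGroup (by decide) (by decide)⟩ by decide] at this
    · have : σ (c * d * d) x = x := by simp only [map_mul_apply', hx, hx2]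
      rwa [show c * d * d = ⟨swap 0 2 * swap 1 3,
        swap_mul_swap_mem_alternatingGroup (by decide) (by decide)⟩ by decide] at this
  exact hne (by rw [hone]; rfl)

end AltSeven

/-! ### Small representations of alternating groups -/

section AltRepresentation

open Equiv

variable {α : Type*} [Fintype α] [DecidableEq α]
variable {V : Type*} [AddCommGroup V] [Module ℂ V]

theorem coe_altEmb_swap_mul_swap {β : Type*} [Fintype β] [DecidableEq β] (e : β ↪ α) {a b c d : β}
    (h : swap a b * swap c d ∈ alternatingGroup β) :
    (altEmb e ⟨swap a b * swap c d, h⟩).1 = swap (e a) (e b) * swap (e c) (e d) := by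
  ext x
  by_cases hx : x ∈ Set.range e
  · obtain ⟨y, rfl⟩ := hx
    rw [altEmb_apply, Perm.mul_apply, Perm.mul_apply, e.injective.map_swap, e.injective.map_swap]
  · have hne : ∀ y, x ≠ e y := fun y hy => hx ⟨y, hy.symm⟩
    rw [altEmb_apply_of_notMem _ _ hx, Perm.mul_apply, swap_apply_of_ne_of_ne (hne _) (hne _),
      swap_apply_of_ne_of_ne (hne _) (hne _)]

theorem coe_altEmb_threeCycle₁ (e : Fin 7 ↪ α) :
    (altEmb e threeCycle₁).1 = swap (e 0) (e 1) * swap (e 1) (e 2) :=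
  coe_altEmb_swap_mul_swap e _

theorem coe_altEmb_threeCycle₂ (e : Fin 7 ↪ α) :
    (altEmb e threeCycle₂).1 = swap (e 3) (e 4) * swap (e 4) (e 5) :=
  coe_altEmb_swap_mul_swap e _

/-- In small dimension, the even permutations of the complement of `{e 0, e 1, e 2}` fix the
eigenvectors of the 3-cycle on these points whose eigenvalue is not `1`. -/
theorem fixes_eigenvector_of_finrank_le_seven [FiniteDimensional ℂ V]
    (hV : Module.finrank ℂ V ≤ 7) (ρ : alternatingGroup α →* Module.End ℂ V) (e : Fin 7 ↪ α)
    {ω : ℂ} (h3 : ω ^ 3 = 1) (h1 : ω ≠ 1) {v : V} (hv : ρ (altEmb e threeCycle₁) v = ω • v)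
    (h : alternatingGroup ({e 0, e 1, e 2}ᶜ : Finset α)) :
    ρ (alternatingGroup.ofSubtype _ h) v = v := by
  revert h
  set s : Finset α := {e 0, e 1, e 2}ᶜ
  intro h
  let H : Subgroup (alternatingGroup s) :=
    { carrier := {h | ρ (alternatingGroup.ofSubtype s h) v = v}
      one_mem' := by simp
      mul_mem' := fun {a b} ha hb => by
        change ρ _ v = v
        rw [map_mul, map_mul_apply', show ρ _ v = v from hb]
        exact ha
      inv_mem' := fun {a} ha => by
        change ρ _ v = v
        nth_rewrite 1 [← (show ρ (alternatingGroup.ofSubtype s a) v = v from ha)]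
        rw [← map_mul_apply', ← map_mul, inv_mul_cancel, map_one, map_one]
        rfl }
  suffices hH : H = ⊤ from (hH ▸ Subgroup.mem_top h : h ∈ H)
  rw [eq_top_iff, ← alternatingGroup.closure_isThreeCycles_eq_top, Subgroup.closure_le]
  intro t (ht : Perm.IsThreeCycle t.1)
  have hmem : ∀ i : Fin 7, i ≠ 0 → i ≠ 1 → i ≠ 2 → e i ∈ s := by
    intro i h0 h1 h2
    simp only [s, Finset.mem_compl, Finset.mem_insert, Finset.mem_singleton, e.injective.eq_iff]
    tauto
  let p3 : s := ⟨e 3, hmem 3 (by decide) (by decide) (by decide)⟩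
  let p4 : s := ⟨e 4, hmem 4 (by decide) (by decide) (by decide)⟩
  let p5 : s := ⟨e 5, hmem 5 (by decide) (by decide) (by decide)⟩
  have n34 : p3 ≠ p4 := fun h => absurd (e.injective (congrArg Subtype.val h)) (by decide)
  have n35 : p3 ≠ p5 := fun h => absurd (e.injective (congrArg Subtype.val h)) (by decide)
  have n45 : p4 ≠ p5 := fun h => absurd (e.injective (congrArg Subtype.val h)) (by decide)
  have ht0 : (swap p3 p4 * swap p4 p5).IsThreeCycle := by
    rw [swap_comm p3 p4]
    exact Perm.isThreeCycle_swap_mul_swap_same n34.symm n45 n35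
  obtain ⟨π, hπ⟩ := isConj_iff.mp ((Perm.isConj_iff_cycleType_eq).mpr (ht0.trans ht.symm))
  let κ : Perm α := Perm.ofSubtype π
  have hκ : ∀ x, x ∉ s → κ x = x := fun x hx => Perm.ofSubtype_apply_of_not_mem π hx
  have ht' : alternatingGroup.ofSubtype s t = altEmb (e.trans κ.toEmbedding) threeCycle₂ := by
    apply Subtype.ext
    rw [coe_altEmb_trans, coe_altEmb_threeCycle₂, alternatingGroup.coe_ofSubtype, ← hπ, map_mul,
      map_mul, map_mul, Perm.ofSubtype_swap_eq, Perm.ofSubtype_swap_eq, map_inv]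
  have hc : altEmb (e.trans κ.toEmbedding) threeCycle₁ = altEmb e threeCycle₁ := by
    apply Subtype.ext
    rw [coe_altEmb_threeCycle₁, coe_altEmb_threeCycle₁]
    have f0 : κ (e 0) = e 0 := hκ _ (by simp [s])
    have f1 : κ (e 1) = e 1 := hκ _ (by simp [s])
    have f2 : κ (e 2) = e 2 := hκ _ (by simp [s])
    simp only [Function.Embedding.trans_apply, Equiv.coe_toEmbedding, f0, f1, f2]
  change ρ (alternatingGroup.ofSubtype s t) v = v
  rw [ht']
  exact threeCycle₂_fixes_eigenvector hV (ρ.comp (altEmb (e.trans κ.toEmbedding))) h3 h1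
    (by rw [MonoidHom.comp_apply, hc]; exact hv)

/-- If the even permutations of `T` permute the vectors `w x` accordingly, then a linear relation
between these vectors has equal coefficients at `p` and `q` unless `w p = w q`. -/
theorem eq_of_nonconstant_relation {ρ : alternatingGroup α →* Module.End ℂ V} {T : Finset α}
    (hT : 4 ≤ T.card) {w : α → V}
    (hw : ∀ h : alternatingGroup α, (∀ x ∉ T, h.1 x = x) → ∀ x ∈ T, ρ h (w x) = w (h.1 x))
    {a : α → ℂ} (ha : ∑ x ∈ T, a x • w x = 0) {p q : α} (hp : p ∈ T) (hq : q ∈ T)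
    (hpq : a p ≠ a q) : w p = w q := by
  have hne : p ≠ q := fun h => hpq (by rw [h])
  obtain ⟨r, hr, t, ht, hrt⟩ : ∃ r ∈ (T.erase p).erase q, ∃ t ∈ (T.erase p).erase q, r ≠ t := by
    rw [← Finset.one_lt_card, Finset.card_erase_of_mem (Finset.mem_erase.mpr ⟨hne.symm, hq⟩),
      Finset.card_erase_of_mem hp]
    omega
  simp only [Finset.mem_erase] at hr ht
  obtain ⟨hrq, hrp, hr⟩ := hr
  obtain ⟨htq, htp, ht⟩ := ht
  let g : alternatingGroup α := ⟨swap p q * swap r t, swap_mul_swap_mem_alternatingGroup hne hrt⟩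
  let τ : alternatingGroup α :=
    ⟨swap q r * swap r t, swap_mul_swap_mem_alternatingGroup hrq.symm hrt⟩
  have gp : g.1 p = q := by simp [g, swap_apply_of_ne_of_ne hrp.symm htp.symm]
  have gq : g.1 q = p := by simp [g, swap_apply_of_ne_of_ne hrq.symm htq.symm]
  have gr : g.1 r = t := by simp [g, swap_apply_of_ne_of_ne htp htq]
  have gt : g.1 t = r := by simp [g, swap_apply_of_ne_of_ne hrp hrq]
  have gx : ∀ x, x ≠ p → x ≠ q → x ≠ r → x ≠ t → g.1 x = x := fun x h1 h2 h3 h4 => by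
    simp [g, swap_apply_of_ne_of_ne h1 h2, swap_apply_of_ne_of_ne h3 h4]
  have τp : τ.1 p = p := by
    simp [τ, swap_apply_of_ne_of_ne hrp.symm htp.symm, swap_apply_of_ne_of_ne hne hrp.symm]
  have τq : τ.1 q = r := by simp [τ, swap_apply_of_ne_of_ne hrq.symm htq.symm]
  have τr : τ.1 r = t := by simp [τ, swap_apply_of_ne_of_ne htq hrt.symm]
  have τt : τ.1 t = q := by simp [τ]
  have τx : ∀ x, x ≠ q → x ≠ r → x ≠ t → τ.1 x = x := fun x h2 h3 h4 => by
    simp [τ, swap_apply_of_ne_of_ne h2 h3, swap_apply_of_ne_of_ne h3 h4]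
  have hg := hw g (fun x hx => gx x (ne_of_mem_of_not_mem hp hx).symm
    (ne_of_mem_of_not_mem hq hx).symm (ne_of_mem_of_not_mem hr hx).symm
    (ne_of_mem_of_not_mem ht hx).symm)
  have hτ := hw τ (fun x hx => τx x (ne_of_mem_of_not_mem hq hx).symm
    (ne_of_mem_of_not_mem hr hx).symm (ne_of_mem_of_not_mem ht hx).symm)
  have hsum : ∑ x ∈ T, a x • (w x - w (g.1 x)) = 0 := by
    have := congrArg (ρ g) ha
    rw [map_sum, map_zero] at this
    simp only [smul_sub, Finset.sum_sub_distrib, ha]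
    rw [zero_sub, neg_eq_zero, ← this]
    exact Finset.sum_congr rfl fun x hx => by rw [map_smul, hg x hx]
  have h4 : ∑ x ∈ ({p, q, r, t} : Finset α), a x • (w x - w (g.1 x)) = 0 := by
    rw [← hsum]
    apply Finset.sum_subset
    · intro x hx
      simp only [Finset.mem_insert, Finset.mem_singleton] at hx
      rcases hx with rfl | rfl | rfl | rfl <;> assumption
    · intro x _ hx
      simp only [Finset.mem_insert, Finset.mem_singleton, not_or] at hx
      rw [gx x hx.1 hx.2.1 hx.2.2.1 hx.2.2.2, sub_self, smul_zero]
  rw [Finset.sum_insert (by simp [hne, hrp.symm, htp.symm]),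
    Finset.sum_insert (by simp [hrq.symm, htq.symm]), Finset.sum_insert (by simp [hrt]),
    Finset.sum_singleton, gp, gq, gr, gt] at h4
  -- the sum of the images of this relation under the powers of `τ` involves `a p - a q` only
  have e0 : (a p - a q) • (w p - w q) + (a r - a t) • (w r - w t) = 0 := by
    rw [← h4]; module
  have e1 := congrArg (ρ τ) e0
  simp only [map_add, map_smul, map_sub, map_zero, hτ p hp, hτ q hq, hτ r hr, hτ t ht,
    τp, τq, τr, τt] at e1
  have e2 := congrArg (ρ τ) e1
  simp only [map_add, map_smul, map_sub, map_zero, hτ p hp, hτ q hq, hτ r hr, hτ t ht,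
    τp, τq, τr, τt] at e2
  have e3 : (a p - a q) • ((3 : ℂ) • w p - w q - w r - w t) = 0 := by
    calc _ = ((a p - a q) • (w p - w q) + (a r - a t) • (w r - w t))
        + ((a p - a q) • (w p - w r) + (a r - a t) • (w t - w q))
        + ((a p - a q) • (w p - w t) + (a r - a t) • (w q - w r)) := by module
      _ = 0 := by rw [e0, e1, e2]; simp
  have e4 := (smul_eq_zero.mp e3).resolve_left (sub_ne_zero.mpr hpq)
  have e5 := congrArg (ρ g) e4
  simp only [map_smul, map_sub, map_zero, hg p hp, hg q hq, hg r hr, hg t ht, gp, gq, gr, gt] at e5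
  have e6 : (4 : ℂ) • (w p - w q) = 0 := by
    calc _ = ((3 : ℂ) • w p - w q - w r - w t) - ((3 : ℂ) • w q - w p - w t - w r) := by module
      _ = 0 := by rw [e4, e5, sub_zero]
  exact sub_eq_zero.mp ((smul_eq_zero.mp e6).resolve_left (by norm_num))

theorem exists_even_apply_eq {S : Finset α} (hS : 4 ≤ S.card) {x y : α} (hx : x ∈ S) (hy : y ∈ S) :
    ∃ g : alternatingGroup α, g.1 x = y ∧ ∀ z ∉ S, g.1 z = z := by
  rcases eq_or_ne x y with rfl | hne
  · exact ⟨1, rfl, fun _ _ => rfl⟩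
  obtain ⟨r, hr, t, ht, hrt⟩ : ∃ r ∈ (S.erase x).erase y, ∃ t ∈ (S.erase x).erase y, r ≠ t := by
    rw [← Finset.one_lt_card, Finset.card_erase_of_mem (Finset.mem_erase.mpr ⟨hne.symm, hy⟩),
      Finset.card_erase_of_mem hx]
    omega
  simp only [Finset.mem_erase] at hr ht
  refine ⟨⟨swap x y * swap r t, swap_mul_swap_mem_alternatingGroup hne hrt⟩, ?_, fun z hz => ?_⟩
  · simp [swap_apply_of_ne_of_ne hr.2.1.symm ht.2.1.symm]
  · have h (u : α) (hu : u ∈ S) : z ≠ u := fun h => hz (h ▸ hu)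
    simp [swap_apply_of_ne_of_ne (h x hx) (h y hy),
      swap_apply_of_ne_of_ne (h r hr.2.2) (h t ht.2.2)]

theorem threeCycle_mul_threeCycle_sq {α : Type*} [DecidableEq α] {i j k l : α} (hij : i ≠ j)
    (hik : i ≠ k) (hjk : j ≠ k) (hil : i ≠ l) (hjl : j ≠ l) (hkl : k ≠ l) :
    (swap i j * swap j k * (swap i j * swap j l)) * (swap i j * swap j k * (swap i j * swap j l))
      = 1 := by
  have e : swap i j * swap j k * (swap i j * swap j l) = swap i k * swap j l := by
    ext x
    simp only [Perm.mul_apply, swap_apply_def]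
    grind
  rw [e]
  ext x
  simp only [Perm.mul_apply, swap_apply_def, Perm.one_apply]
  grind

/-- If the even permutations of the complement of `{e 0, e 1, e 2}` fix all the eigenvectors of the
3-cycle on these points with eigenvalue different from `1`, then in dimension at most `n - 3` there
are no such eigenvectors: the `n - 2` translates of one of them would span a space of dimension
`n - 3` with too few vectors fixed by the permutations of the complement. -/
theorem eigenvector_eq_zero_of_fixed [FiniteDimensional ℂ V] (e : Fin 7 ↪ α)
    (hd : Module.finrank ℂ V + 3 ≤ Fintype.card α) (ρ : alternatingGroup α →* Module.End ℂ V)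
    (hfix : ∀ (η : ℂ) (x : V), η ^ 3 = 1 → η ≠ 1 → ρ (altEmb e threeCycle₁) x = η • x →
      ∀ h : alternatingGroup α, h.1 (e 0) = e 0 → h.1 (e 1) = e 1 → h.1 (e 2) = e 2 → ρ h x = x)
    {ω : ℂ} (h3 : ω ^ 3 = 1) (h1 : ω ≠ 1) {v : V} (hv : ρ (altEmb e threeCycle₁) v = ω • v) :
    v = 0 := by
  classical
  by_contra hv0
  have h7 : 7 ≤ Fintype.card α := by simpa using Fintype.card_le_of_embedding e
  set c := altEmb e threeCycle₁ with hc
  have hcv : c.1 = swap (e 0) (e 1) * swap (e 1) (e 2) := coe_altEmb_threeCycle₁ e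
  set i := e 0 with hi
  set j := e 1 with hj
  set k := e 2 with hk
  have hij : i ≠ j := fun h => absurd (e.injective h) (by decide)
  have hik : i ≠ k := fun h => absurd (e.injective h) (by decide)
  have hjk : j ≠ k := fun h => absurd (e.injective h) (by decide)
  let T : Finset α := {i, j}ᶜ
  have hmemT : ∀ x, x ∈ T ↔ x ≠ i ∧ x ≠ j := fun x => by simp [T]
  have hTcard : T.card = Fintype.card α - 2 := by
    rw [Finset.card_compl, Finset.card_pair hij]
  have hkT : k ∈ T := (hmemT k).mpr ⟨hik.symm, hjk.symm⟩
  have hiT : i ∉ T := fun h => ((hmemT i).mp h).1 rfl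
  have hjT : j ∉ T := fun h => ((hmemT j).mp h).2 rfl
  -- the translates of `v`, indexed by the image of `k`
  let P : α → alternatingGroup α → Prop := fun x g => g.1 i = i ∧ g.1 j = j ∧ g.1 k = x
  let w : α → V := fun x => if h : ∃ g, P x g then ρ h.choose v else 0
  have hw0 : ∀ (g : alternatingGroup α) (x : α), P x g → w x = ρ g v := by
    intro g x hg
    have hex : ∃ g, P x g := ⟨g, hg⟩
    have hspec : P x hex.choose := hex.choose_spec
    simp only [w, dif_pos hex]
    set g₀ := hex.choose
    have hinv : ∀ y z, g.1 y = z → g₀.1 y = z → (g⁻¹ * g₀).1 y = y := by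
      intro y z h1 h2
      change g.1⁻¹ (g₀.1 y) = y
      rw [h2, ← h1, Perm.inv_def, Equiv.symm_apply_apply]
    have := hfix ω v h3 h1 hv (g⁻¹ * g₀) (hinv _ _ hg.1 hspec.1) (hinv _ _ hg.2.1 hspec.2.1)
      (hinv _ _ hg.2.2 hspec.2.2)
    nth_rewrite 2 [← this]
    rw [← map_mul_apply', mul_inv_cancel_left]
  have hwk : w k = v := by rw [hw0 1 k ⟨rfl, rfl, rfl⟩, map_one]; rfl
  have hexP : ∀ x ∈ T, ∃ g, P x g := fun x hx => by
    obtain ⟨g, hg1, hg2⟩ := exists_even_apply_eq (S := T) (by omega) hkT hx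
    exact ⟨g, hg2 i hiT, hg2 j hjT, hg1⟩
  have hw : ∀ h : alternatingGroup α, (∀ x ∉ T, h.1 x = x) → ∀ x ∈ T, ρ h (w x) = w (h.1 x) := by
    intro h hh x hx
    obtain ⟨g, hg⟩ := hexP x hx
    rw [hw0 g x hg, hw0 (h * g) (h.1 x) ⟨?_, ?_, ?_⟩, map_mul_apply']
    · change h.1 (g.1 i) = i; rw [hg.1, hh i hiT]
    · change h.1 (g.1 j) = j; rw [hg.2.1, hh j hjT]
    · change h.1 (g.1 k) = h.1 x; rw [hg.2.2]
  -- the translates are distinct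
  have hinj : ∀ p ∈ T, ∀ q ∈ T, p ≠ q → w p ≠ w q := by
    intro p hp q hq hpq hwpq
    obtain ⟨g, hg⟩ := hexP p hp
    have hgT : ∀ x ∉ T, (g⁻¹).1 x = x := by
      intro x hx
      change g.1⁻¹ x = x
      rw [Perm.inv_eq_iff_eq]
      rw [hmemT, not_and_or, not_not, not_not] at hx
      rcases hx with rfl | rfl
      · exact hg.1.symm
      · exact hg.2.1.symm
    have gk : (g⁻¹).1 p = k := by
      change g.1⁻¹ p = k
      rw [Perm.inv_eq_iff_eq]
      exact hg.2.2.symm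
    set l := (g⁻¹).1 q with hl
    have hlk : k ≠ l := by
      rw [← gk]
      exact fun h => hpq ((g⁻¹).1.injective h)
    have hli : i ≠ l := by
      rw [← hgT i hiT]
      exact fun h => hiT ((g⁻¹).1.injective h ▸ hq)
    have hlj : j ≠ l := by
      rw [← hgT j hjT]
      exact fun h => hjT ((g⁻¹).1.injective h ▸ hq)
    have hwl : w l = v := by
      rw [← hwk, ← gk, ← hw _ hgT p hp, hwpq, hw _ hgT q hq]
    obtain ⟨h, hh⟩ := hexP l ((hmemT l).mpr ⟨hli.symm, hlj.symm⟩)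
    have hc' : ρ (h * c * h⁻¹) v = ω • v := by
      nth_rewrite 1 [← hwl]
      rw [hw0 h l hh, ← map_mul_apply', inv_mul_cancel_right, map_mul_apply', hv, map_smul,
        ← hw0 h l hh, hwl]
    have hcc : (c * (h * c * h⁻¹)) * (c * (h * c * h⁻¹)) = 1 := by
      apply Subtype.ext
      have : (h * c * h⁻¹).1 = swap i j * swap j l := by
        change h.1 * c.1 * h.1⁻¹ = _
        have s₁ := Equiv.swap_apply_apply h.1 i j
        have s₂ := Equiv.swap_apply_apply h.1 j k
        rw [hh.1, hh.2.1] at s₁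
        rw [hh.2.1, hh.2.2] at s₂
        rw [hcv]
        calc h.1 * (swap i j * swap j k) * h.1⁻¹
            = (h.1 * swap i j * h.1⁻¹) * (h.1 * swap j k * h.1⁻¹) := by group
          _ = swap i j * swap j l := by rw [← s₁, ← s₂]
      change c.1 * (h * c * h⁻¹).1 * (c.1 * (h * c * h⁻¹).1) = 1
      rw [this, hcv]
      exact threeCycle_mul_threeCycle_sq hij hik hjk hli hlj hlk
    have := congrArg (fun g => ρ g v) hcc
    simp only [map_mul_apply' ρ c, map_mul_apply' ρ (c * (h * c * h⁻¹)), hc', map_smul, hv,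
      map_one, Module.End.one_apply, smul_smul] at this
    have e4 : ω * ω * ω * ω = ω := by linear_combination ω * h3
    have : (ω - 1) • v = 0 := by
      rw [sub_smul, one_smul, sub_eq_zero, ← e4]
      convert this using 2
    rcases smul_eq_zero.mp this with h | h
    · exact h1 (sub_eq_zero.mp h)
    · exact hv0 h
  have hrel : ∀ a : α → ℂ, ∑ x ∈ T, a x • w x = 0 → ∀ p ∈ T, ∀ q ∈ T, a p = a q := by
    intro a ha p hp q hq
    by_contra hpq
    exact hinj p hp q hq (fun h => hpq (by rw [h]))
      (eq_of_nonconstant_relation (by omega) hw ha hp hq hpq)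
  -- all but one of the translates form a basis
  have hext : ∀ b : (T.erase k) → ℂ, ∃ a : α → ℂ, a k = 0 ∧ (∀ x : T.erase k, a x = b x) ∧
      ∑ x ∈ T, a x • w x = ∑ x : T.erase k, b x • w x := by
    intro b
    let a : α → ℂ := fun x => if h : x ∈ T.erase k then b ⟨x, h⟩ else 0
    have hak : a k = 0 := dif_neg (Finset.notMem_erase k T)
    have hab : ∀ x : T.erase k, a x = b x := fun x => dif_pos x.2
    refine ⟨a, hak, hab, ?_⟩
    rw [← Finset.add_sum_erase T _ hkT, hak, zero_smul, zero_add,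
      ← Finset.sum_coe_sort (T.erase k)]
    exact Finset.sum_congr rfl fun x _ => by rw [hab x]
  have hLI : LinearIndependent ℂ (fun x : T.erase k => w x) := by
    rw [Fintype.linearIndependent_iff]
    intro b hb x
    obtain ⟨a, hak, hab, hsum⟩ := hext b
    rw [← hab x, ← hak]
    exact hrel a (hsum.trans hb) _ (Finset.mem_of_mem_erase x.2) _ hkT
  have hcardE : Fintype.card (T.erase k) = Fintype.card α - 3 := by
    rw [Fintype.card_coe, Finset.card_erase_of_mem hkT, hTcard]
    omega
  have hle := hLI.fintype_card_le_finrank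
  have hspan := hLI.span_eq_top_of_card_eq_finrank' (by omega)
  have hmemspan : ∀ x : V, ∃ b : T.erase k → ℂ, ∑ i, b i • w i = x := by
    intro x
    rw [← Submodule.mem_span_range_iff_exists_fun, hspan]
    trivial
  -- the vectors fixed by the even permutations of the complement are multiples of `v`
  have hmult : ∀ x : V, (∀ h : alternatingGroup α, h.1 i = i → h.1 j = j → h.1 k = k → ρ h x = x) →
      ∃ s : ℂ, x = s • v := by
    intro x hx
    obtain ⟨b, hb⟩ := hmemspan x
    obtain ⟨a, hak, hab, hsum⟩ := hext b
    rw [hb] at hsum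
    have hconst : ∀ p ∈ T.erase k, ∀ q ∈ T.erase k, a p = a q := by
      intro p hp q hq
      obtain ⟨g, hgq, hgx⟩ := exists_even_apply_eq (S := T.erase k)
        (by rw [Finset.card_erase_of_mem hkT]; omega) hq hp
      have gk : g.1 k = k := hgx k (Finset.notMem_erase k T)
      have gT : ∀ x ∉ T, g.1 x = x := fun x hx => hgx x fun h => hx (Finset.mem_of_mem_erase h)
      have gmem : ∀ x, g.1 x ∈ T ↔ x ∈ T := by
        intro x
        by_cases hx : x ∈ T
        · refine ⟨fun _ => hx, fun _ => ?_⟩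
          by_contra h
          have := gT _ h
          exact h (by rwa [g.1.injective this])
        · rw [gT x hx]
      have e2 : ∑ x ∈ T, a x • w (g.1 x) = x := by
        rw [← hx g (gT i hiT) (gT j hjT) gk]
        nth_rewrite 1 [← hsum]
        rw [map_sum]
        exact Finset.sum_congr rfl fun y hy => by rw [map_smul, hw g gT y hy]
      have e3 : ∑ x ∈ T, (a (g.1.symm x) - a x) • w x = 0 := by
        have : ∑ x ∈ T, a (g.1.symm x) • w x = x := by
          rw [← e2]
          symm
          exact Finset.sum_bij (fun x _ => g.1 x) (fun x hx => (gmem x).mpr hx)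
            (fun _ _ _ _ h => g.1.injective h)
            (fun y hy => ⟨g.1.symm y, by rw [← gmem, Equiv.apply_symm_apply]; exact hy,
              Equiv.apply_symm_apply _ _⟩)
            (fun y _ => by rw [Equiv.symm_apply_apply])
        simp only [sub_smul, Finset.sum_sub_distrib, this, hsum, sub_self]
      have e4 := hrel _ e3 p (Finset.mem_of_mem_erase hp) k hkT
      rw [g.1.symm_apply_eq.mpr gk.symm, sub_self, sub_eq_zero, g.1.symm_apply_eq.mpr hgq.symm] at e4
      exact e4.symm
    -- a relation between all the translates is a multiple of their sum
    have hzero : ∑ x ∈ T, w x = 0 := by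
      obtain ⟨b', hb'⟩ := hmemspan v
      obtain ⟨a', ha'k, ha'b, hsum'⟩ := hext b'
      have hr : ∑ x ∈ T, (a' x - if x = k then 1 else 0) • w x = 0 := by
        simp only [sub_smul, Finset.sum_sub_distrib, hsum', hb', ite_smul, one_smul, zero_smul,
          Finset.sum_ite_eq', hkT, if_true, hwk, sub_self]
      have hr' := hrel _ hr
      rw [← neg_eq_zero, ← hr, ← Finset.sum_neg_distrib]
      refine Finset.sum_congr rfl fun x hx => ?_
      rw [hr' x hx k hkT, ha'k, if_pos rfl, zero_sub, neg_smul, one_smul]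
    obtain ⟨p, hp⟩ : (T.erase k).Nonempty := by
      rw [← Finset.card_pos, Finset.card_erase_of_mem hkT]; omega
    refine ⟨-a p, ?_⟩
    have hE : ∑ x ∈ T.erase k, w x = -v := by
      rw [← Finset.add_sum_erase T _ hkT, hwk] at hzero
      exact (neg_eq_of_add_eq_zero_right hzero).symm
    rw [← hsum, ← Finset.add_sum_erase T _ hkT, hak, zero_smul, zero_add, neg_smul, ← smul_neg, ← hE,
      Finset.smul_sum]
    exact Finset.sum_congr rfl fun x hx => by rw [hconst x hx p hp]
  -- but there is also an eigenvector for the inverse eigenvalue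
  let s₀ : alternatingGroup (Fin 7) := ⟨swap 0 1 * swap 3 4,
    swap_mul_swap_mem_alternatingGroup (by decide) (by decide)⟩
  have hsc : c * altEmb e s₀ = altEmb e s₀ * (c * c) := by
    rw [hc, ← map_mul, ← map_mul, ← map_mul,
      show threeCycle₁ * s₀ = s₀ * (threeCycle₁ * threeCycle₁) by decide]
  have hbar : ρ c (ρ (altEmb e s₀) v) = ω ^ 2 • ρ (altEmb e s₀) v := by
    rw [← map_mul_apply', hsc, map_mul_apply', map_mul_apply', hv, map_smul, hv, smul_smul,
      map_smul, sq]
  obtain ⟨g3, g1, g2⟩ := cube_root_sq h3 h1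
  obtain ⟨s, hs⟩ := hmult _ (hfix _ _ g3 g1 hbar)
  have hs0 : ρ (altEmb e s₀) v ≠ 0 := by
    intro h0
    have := congrArg (ρ (altEmb e s₀)⁻¹) h0
    rw [← map_mul_apply', inv_mul_cancel, map_one, map_zero] at this
    exact hv0 this
  have hbar' : ρ c (ρ (altEmb e s₀) v) = ω • ρ (altEmb e s₀) v := by
    rw [hs, map_smul, hv, smul_comm]
  have : (ω ^ 2 - ω) • ρ (altEmb e s₀) v = 0 := by
    rw [sub_smul, ← hbar, ← hbar', sub_self]
  rcases smul_eq_zero.mp this with h | h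
  · exact g2 (sub_eq_zero.mp h)
  · exact hs0 h

/-- A representation of the alternating group of degree `n ≥ 7` of dimension at most `n - 3` is
trivial. -/
theorem alternatingGroup_representation_eq_one {α : Type} [Fintype α] [DecidableEq α]
    (h7 : 7 ≤ Fintype.card α) [FiniteDimensional ℂ V] (hd : Module.finrank ℂ V + 3 ≤ Fintype.card α)
    (ρ : alternatingGroup α →* Module.End ℂ V) : ρ = 1 := by
  obtain ⟨n, hn⟩ : ∃ n, Fintype.card α = n := ⟨_, rfl⟩
  induction n using Nat.strong_induction_on generalizing α V with
  | _ n ih =>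
  obtain ⟨e⟩ : Nonempty (Fin 7 ↪ α) := by
    rw [Function.Embedding.nonempty_iff_card_le]; simpa using h7
  set c := altEmb e threeCycle₁ with hc
  have hc3 : ρ c ^ 3 = 1 := by
    rw [← map_pow, hc, ← map_pow, threeCycle₁_pow_three, map_one, map_one]
  have hcne : c ≠ 1 := by
    intro h
    have h0 : c.1 (e 0) = e 0 := by rw [h]; rfl
    rw [hc, altEmb_apply] at h0
    exact absurd (e.injective h0) (by decide)
  by_contra hρ
  have hρc : ρ c ≠ 1 := fun h => hρ (eq_one_of_map_eq_one (by omega) ρ hcne h)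
  obtain ⟨x, hx⟩ : ∃ x, ρ c x ≠ x := by
    by_contra! h
    exact hρc (LinearMap.ext h)
  obtain ⟨v, ω, hv0, h3, h1, hv, -⟩ := exists_eigenvector_of_cube hc3 hx
  refine hv0 (eigenvector_eq_zero_of_fixed e hd ρ ?_ h3 h1 hv)
  intro η y e3 e1 hy h hh0 hh1 hh2
  let s : Finset α := {e 0, e 1, e 2}ᶜ
  have hcard : s.card = n - 3 := by
    rw [Finset.card_compl, hn, Finset.card_insert_of_notMem, Finset.card_pair]
    · exact fun h => absurd (e.injective h) (by decide)
    · simp [e.injective.eq_iff]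
  obtain ⟨h, rfl⟩ : h ∈ (alternatingGroup.ofSubtype s).range := by
    rw [alternatingGroup.mem_range_ofSubtype_iff]
    intro z hz
    rw [Perm.mem_support] at hz
    simp only [s, Finset.mem_compl, Finset.mem_insert, Finset.mem_singleton, not_or]
    refine ⟨?_, ?_, ?_⟩ <;> rintro rfl <;> contradiction
  rcases le_or_gt n 9 with h9 | h9
  · exact fixes_eigenvector_of_finrank_le_seven (by omega) ρ e e3 e1 hy h
  -- the eigenspaces of the 3-cycle for `η` and `η⁻¹` have the same dimension
  let E : ℂ → Submodule ℂ V := fun μ => Module.End.eigenspace (ρ c) μ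
  have hE : ∀ μ x, x ∈ E μ ↔ ρ c x = μ • x := fun μ x => Module.End.mem_eigenspace_iff
  let s₀ : alternatingGroup (Fin 7) := ⟨swap 0 1 * swap 3 4,
    swap_mul_swap_mem_alternatingGroup (by decide) (by decide)⟩
  have hsc : c * altEmb e s₀ = altEmb e s₀ * (c * c) := by
    rw [hc, ← map_mul, ← map_mul, ← map_mul,
      show threeCycle₁ * s₀ = s₀ * (threeCycle₁ * threeCycle₁) by decide]
  have hinj : Function.Injective (ρ (altEmb e s₀)) := by
    intro x y hxy
    have := congrArg (ρ (altEmb e s₀)⁻¹) hxy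
    rwa [← map_mul_apply', ← map_mul_apply', inv_mul_cancel, map_one] at this
  have hmap : ∀ x ∈ E η, ρ (altEmb e s₀) x ∈ E (η ^ 2) := by
    intro x hx
    rw [hE] at hx ⊢
    rw [← map_mul_apply', hsc, map_mul_apply', map_mul_apply', hx, map_smul, hx, smul_smul,
      map_smul, sq]
  have hle : Module.finrank ℂ (E η) ≤ Module.finrank ℂ (E (η ^ 2)) :=
    LinearMap.finrank_le_finrank_of_injective
      (f := (ρ (altEmb e s₀)).restrict hmap)
      (fun x y hxy => Subtype.ext (hinj (congrArg Subtype.val hxy)))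
  have hdisj : Disjoint (E η) (E (η ^ 2)) := by
    rw [Submodule.disjoint_def]
    intro x hx hx'
    rw [hE] at hx hx'
    have : (η ^ 2 - η) • x = 0 := by rw [sub_smul, ← hx, ← hx', sub_self]
    exact (smul_eq_zero.mp this).resolve_left (sub_ne_zero.mpr (cube_root_sq e3 e1).2.2)
  have hsum := Submodule.finrank_add_finrank_le_of_disjoint hdisj
  -- so the induction hypothesis applies to the representation on the eigenspace
  have hcomm : ∀ g : alternatingGroup s, c * alternatingGroup.ofSubtype s g =
      alternatingGroup.ofSubtype s g * c := by
    intro g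
    apply Subtype.ext
    apply Perm.Disjoint.commute
    intro z
    by_cases hz : z ∈ s
    · left
      by_cases hze : z ∈ Set.range e
      · obtain ⟨t, rfl⟩ := hze
        rw [hc, altEmb_apply]
        congr 1
        have key : ∀ t : Fin 7, t ≠ 0 ∧ t ≠ 1 ∧ t ≠ 2 → threeCycle₁.1 t = t := by decide
        exact key t (by simpa [s, e.injective.eq_iff] using hz)
      · exact altEmb_apply_of_notMem _ _ hze
    · right
      exact Perm.ofSubtype_apply_of_not_mem g.1 hz
  have hstab : ∀ (g : alternatingGroup s), ∀ x ∈ E η, ρ (alternatingGroup.ofSubtype s g) x ∈ E η := by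
    intro g x hx
    rw [hE] at hx ⊢
    rw [← map_mul_apply', hcomm, map_mul_apply', hx, map_smul]
  let σ : alternatingGroup s →* Module.End ℂ (E η) :=
    { toFun := fun g => (ρ (alternatingGroup.ofSubtype s g)).restrict (hstab g)
      map_one' := by ext x; simp
      map_mul' := fun a b => by ext x; simp }
  have hσ : σ = 1 := ih (n - 3) (by omega) (by rw [Fintype.card_coe]; omega)
    (by rw [Fintype.card_coe]; omega) σ (by rw [Fintype.card_coe]; omega)
  have := congrArg (fun f : alternatingGroup s →* Module.End ℂ (E η) =>
    (f h ⟨y, (hE η y).mpr hy⟩ : V)) hσ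
  exact this

end AltRepresentation

/-! ### The top singular value of an operator -/

section Spectral

open scoped InnerProductSpace

variable {E : Type*} [NormedAddCommGroup E] [InnerProductSpace ℂ E] [FiniteDimensional ℂ E]

/-- The largest eigenvalue `μ` of `T†T` is the square of the operator norm of `T`, and `μ` times its
multiplicity is at most the square of the Hilbert-Schmidt norm of `T`. -/
theorem exists_top_eigenvalue [Nontrivial E] {ι : Type*} [Fintype ι] (b : OrthonormalBasis ι ℂ E)
    (T : E →ₗ[ℂ] E) :
    ∃ μ : ℝ, 0 ≤ μ ∧ (∀ x, ‖T x‖ ^ 2 ≤ μ * ‖x‖ ^ 2) ∧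
      Module.End.HasEigenvalue (LinearMap.adjoint T * T) (μ : ℂ) ∧
      μ * Module.finrank ℂ (Module.End.eigenspace (LinearMap.adjoint T * T) (μ : ℂ))
        ≤ ∑ i, ‖T (b i)‖ ^ 2 := by
  classical
  set S : E →ₗ[ℂ] E := LinearMap.adjoint T * T with hSdef
  have hS : S.IsSymmetric := LinearMap.isSymmetric_adjoint_mul_self T
  have hST : ∀ x, ⟪x, S x⟫_ℂ = ((‖T x‖ ^ 2 : ℝ) : ℂ) := by
    intro x
    rw [hSdef, Module.End.mul_apply, LinearMap.adjoint_inner_right, inner_self_eq_norm_sq_to_K]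
    norm_cast
  have hn0 : 0 < Module.finrank ℂ E := Module.finrank_pos
  have hn : Module.finrank ℂ E = Module.finrank ℂ E := rfl
  let m := hS.eigenvalues hn
  let v := hS.eigenvectorBasis hn
  have hSv : ∀ i, S (v i) = (m i : ℂ) • v i := hS.apply_eigenvectorBasis hn
  have hm0 : ∀ i, m i = ‖T (v i)‖ ^ 2 := by
    intro i
    have := hST (v i)
    rw [hSv, inner_smul_right, inner_self_eq_norm_sq_to_K, v.orthonormal.1 i] at this
    simp only [RCLike.ofReal_one, one_pow, mul_one] at this
    exact_mod_cast this
  have : Nonempty (Fin (Module.finrank ℂ E)) := ⟨⟨0, hn0⟩⟩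
  obtain ⟨i₀, -, hi₀⟩ := Finset.exists_max_image Finset.univ m Finset.univ_nonempty
  have hpos : ∀ i, 0 ≤ m i := fun i => by rw [hm0]; positivity
  refine ⟨m i₀, hpos i₀, fun x => ?_, hS.hasEigenvalue_eigenvalues hn i₀, ?_⟩
  · have h1 : ((‖T x‖ ^ 2 : ℝ) : ℂ) = ((∑ i, m i * ‖⟪v i, x⟫_ℂ‖ ^ 2 : ℝ) : ℂ) := by
      rw [← hST, ← OrthonormalBasis.sum_inner_mul_inner v]
      push_cast
      refine Finset.sum_congr rfl fun i _ => ?_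
      rw [← hS (v i) x, hSv, inner_smul_left, ← inner_conj_symm x (v i), Complex.conj_ofReal,
        ← mul_assoc, mul_comm _ ((m i : ℝ) : ℂ), mul_assoc]
      congr 1
      exact_mod_cast RCLike.conj_mul (⟪v i, x⟫_ℂ)
    have h2 : ‖T x‖ ^ 2 = ∑ i, m i * ‖⟪v i, x⟫_ℂ‖ ^ 2 := by exact_mod_cast h1
    rw [h2, ← v.sum_sq_norm_inner_right x, Finset.mul_sum]
    exact Finset.sum_le_sum fun i _ =>
      mul_le_mul_of_nonneg_right (hi₀ i (Finset.mem_univ i)) (by positivity)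
  · have h1 : ∑ i, ‖T (b i)‖ ^ 2 = ∑ i, m i := by
      rw [← hS.re_trace_eq_sum_eigenvalues hn, LinearMap.trace_eq_sum_inner S b, map_sum]
      exact Finset.sum_congr rfl fun i _ => by rw [hST]; rfl
    rw [h1, ← hS.card_filter_eigenvalues_eq hn]
    calc m i₀ * _ = ∑ i ∈ Finset.univ.filter (fun i => ((m i : ℝ) : ℂ) = (m i₀ : ℝ)), m i := by
          rw [Finset.sum_congr rfl (g := fun _ => m i₀), Finset.sum_const, nsmul_eq_mul, mul_comm]
          · rfl
          · intro i hi
            exact_mod_cast (Finset.mem_filter.mp hi).2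
      _ ≤ ∑ i, m i := Finset.sum_le_univ_sum_of_nonneg hpos

end Spectral

/-! ### Product-free sets in finite groups -/

section FiniteGroup

variable {Q : Type*} [Group Q]

theorem le_finrank_of_forall_GL {D : ℕ}
    (hD : ∀ (d : ℕ) (ρ : Q →* GL (Fin d) ℂ), ρ ≠ 1 → D ≤ d)
    {V : Type*} [AddCommGroup V] [Module ℂ V] [FiniteDimensional ℂ V] (ρ : Q →* Module.End ℂ V)
    (hρ : ρ ≠ 1) : D ≤ Module.finrank ℂ V := by
  let b := Module.finBasis ℂ V
  let A := LinearMap.toMatrixAlgEquiv b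
  let σ : Q →* Matrix (Fin (Module.finrank ℂ V)) (Fin (Module.finrank ℂ V)) ℂ :=
    (A : Module.End ℂ V →* _).comp ρ
  apply hD _ σ.toHomUnits
  intro h
  apply hρ
  ext1 g
  have h1 : σ g = 1 := congrArg (fun f : Q →* GL _ ℂ => (f g).val) h
  exact A.injective (h1.trans (map_one A).symm)

variable [Fintype Q]

open Classical in
/-- Gowers' bound: a product-free subset of a finite group whose non-trivial representations all
have dimension at least `D` has density at most `D ^ (-1/3)`. -/
theorem card_pow_three_mul_le {D : ℕ} (hD : ∀ (d : ℕ) (ρ : Q →* GL (Fin d) ℂ), ρ ≠ 1 → D ≤ d)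
    (B : Finset Q) (hB : ∀ a ∈ B, ∀ b ∈ B, a * b ∉ B) :
    (B.card : ℝ) ^ 3 * D ≤ (Fintype.card Q : ℝ) ^ 3 := by
  let E := EuclideanSpace ℂ Q
  set n : ℝ := (Fintype.card Q : ℝ) with hn
  have hn0 : 0 < n := by rw [hn]; exact_mod_cast Fintype.card_pos
  set β : ℝ := B.card / n with hβ
  have hβn : β * n = B.card := div_mul_cancel₀ _ hn0.ne'
  let a : Q → ℝ := fun y => (if y ∈ B then 1 else 0) - β
  have hasum : ∑ y, a y = 0 := by
    simp only [a, Finset.sum_sub_distrib, Finset.sum_ite_mem, Finset.univ_inter, Finset.sum_const,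
      Finset.card_univ, nsmul_eq_mul, mul_one]
    rw [← hn, mul_comm, hβn, sub_self]
  have hasq : ∑ y, a y ^ 2 ≤ B.card := by
    have h1 : ∀ y, a y ^ 2 = (1 - 2 * β) * (if y ∈ B then 1 else 0) + β ^ 2 := by
      intro y
      by_cases hy : y ∈ B
      · simp only [a, hy, if_true]; ring
      · simp only [a, hy, if_false]; ring
    simp only [h1, Finset.sum_add_distrib, ← Finset.mul_sum, Finset.sum_ite_mem, Finset.univ_inter,
      Finset.sum_const, Finset.card_univ, nsmul_eq_mul, mul_one]
    rw [← hn, ← hβn]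
    nlinarith [mul_nonneg (sq_nonneg β) hn0.le]
  let M : Matrix Q Q ℂ := fun x z => (a (x⁻¹ * z) : ℂ)
  let T : E →ₗ[ℂ] E := Matrix.toEuclideanLin M
  have hTapp : ∀ (f : E) (x : Q), T f x = ∑ z, M x z * f z := fun f x => rfl
  obtain ⟨μ, hμ0, hbound, heig, hmult⟩ := exists_top_eigenvalue (EuclideanSpace.basisFun Q ℂ) T
  set S : E →ₗ[ℂ] E := LinearMap.adjoint T * T with hS
  have hTadj : LinearMap.adjoint T = Matrix.toEuclideanLin M.conjTranspose :=
    (Matrix.toEuclideanLin_conjTranspose_eq_adjoint M).symm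
  -- left translations
  let L : Q →* Module.End ℂ E :=
    { toFun := fun g =>
        { toFun := fun f => WithLp.toLp 2 fun x => f (g⁻¹ * x)
          map_add' := fun _ _ => rfl
          map_smul' := fun _ _ => rfl }
      map_one' := by ext f x; simp
      map_mul' := fun g h => by ext f x; simp [mul_assoc]; rfl }
  have hLapp : ∀ g (f : E) x, L g f x = f (g⁻¹ * x) := fun _ _ _ => rfl
  have hcomm : ∀ N : Matrix Q Q ℂ, (∀ g x z, N (g * x) (g * z) = N x z) → ∀ g (f : E),
      Matrix.toEuclideanLin N (L g f) = L g (Matrix.toEuclideanLin N f) := by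
    intro N hN g f
    ext x
    change ∑ z, N x z * f (g⁻¹ * z) = ∑ z, N (g⁻¹ * x) z * f z
    refine Fintype.sum_equiv (Equiv.mulLeft g⁻¹) _ _ fun z => ?_
    rw [Equiv.coe_mulLeft, hN]
  have hM : ∀ g x z, M (g * x) (g * z) = M x z := by
    intro g x z
    simp only [M]
    congr 2
    group
  have hSL : ∀ g f, S (L g f) = L g (S f) := by
    intro g f
    rw [hS, Module.End.mul_apply, Module.End.mul_apply, hcomm M hM, hTadj,
      hcomm _ (fun g x z => by rw [Matrix.conjTranspose_apply, hM, Matrix.conjTranspose_apply])]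
  have hHS : ∑ i, ‖T (EuclideanSpace.basisFun Q ℂ i)‖ ^ 2 ≤ n * B.card := by
    have h1 : ∀ i, ‖T (EuclideanSpace.basisFun Q ℂ i)‖ ^ 2 = ∑ y, a y ^ 2 := by
      intro i
      rw [EuclideanSpace.norm_sq_eq]
      refine Fintype.sum_equiv ((Equiv.inv Q).trans (Equiv.mulRight i)) _ _ fun x => ?_
      have : T (EuclideanSpace.basisFun Q ℂ i) x = M x i := by
        rw [hTapp]
        simp [EuclideanSpace.basisFun_apply, PiLp.single_apply]
      rw [this, Complex.norm_real, Real.norm_eq_abs, sq_abs]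
      rfl
    simp only [h1, Finset.sum_const, Finset.card_univ, nsmul_eq_mul]
    rw [← hn]
    gcongr
  have hmain : μ * D ≤ n * B.card := by
    rcases hμ0.eq_or_lt with h0 | hpos
    · rw [← h0, zero_mul]; positivity
    refine le_trans ?_ (hmult.trans hHS)
    gcongr
    set F := Module.End.eigenspace S (μ : ℂ)
    have hstab : ∀ g, ∀ f ∈ F, L g f ∈ F := by
      intro g f hf
      rw [Module.End.mem_eigenspace_iff] at hf ⊢
      rw [hSL, hf, map_smul]
    let σ : Q →* Module.End ℂ F :=
      { toFun := fun g => (L g).restrict (hstab g)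
        map_one' := by ext x; simp
        map_mul' := fun a b => by ext x; simp }
    apply le_finrank_of_forall_GL hD σ
    intro hσ
    apply heig
    rw [Submodule.eq_bot_iff]
    intro f hf
    have hfix : ∀ g, L g f = f := fun g =>
      congrArg (fun s : Q →* Module.End ℂ F => (s g ⟨f, hf⟩ : E)) hσ
    have hTf : T f = 0 := by
      ext x
      have hc : ∀ z, f z = f 1 := fun z => by
        have := congrArg (fun h : E => h z) (hfix z)
        simp only [hLapp, inv_mul_cancel] at this
        exact this.symm
      rw [hTapp]
      have hrow : ∑ z, M x z = 0 := by
        rw [← Fintype.sum_equiv (Equiv.mulLeft x) (fun y => (a y : ℂ)) _ (fun y => by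
          rw [Equiv.coe_mulLeft]; simp only [M, inv_mul_cancel_left])]
        exact_mod_cast hasum
      simp only [hc, ← Finset.sum_mul, hrow, zero_mul]
      rfl
    rw [Module.End.mem_eigenspace_iff, hS, Module.End.mul_apply, hTf, map_zero] at hf
    exact (smul_eq_zero.mp hf.symm).resolve_left (by exact_mod_cast hpos.ne')
  let f : E := WithLp.toLp 2 fun x => if x ∈ B then 1 else 0
  have hf : ‖f‖ ^ 2 = B.card := by
    rw [EuclideanSpace.norm_sq_eq]
    have : ∀ x, ‖f x‖ ^ 2 = if x ∈ B then (1 : ℝ) else 0 := fun x => by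
      change ‖(if x ∈ B then (1 : ℂ) else 0)‖ ^ 2 = _
      split_ifs <;> simp
    simp [this]
  have hinner : inner ℂ f (T f) = ((-β * B.card ^ 2 : ℝ) : ℂ) := by
    have hTf : ∀ x ∈ B, T f x = ((-β * B.card : ℝ) : ℂ) := by
      intro x hx
      rw [hTapp]
      -- for `x, z ∈ B` the entry is `-β`, because `x * (x⁻¹ * z) ∈ B`
      have : ∀ z, M x z * f z = if z ∈ B then ((-β : ℝ) : ℂ) else 0 := by
        intro z
        change M x z * (if z ∈ B then (1 : ℂ) else 0) = _
        split_ifs with hz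
        · have : x⁻¹ * z ∉ B := fun h => hB x hx _ h (by rwa [mul_inv_cancel_left])
          simp only [M, a, this, if_false, zero_sub, mul_one]
        · rw [mul_zero]
      simp only [this, Finset.sum_ite_mem, Finset.univ_inter, Finset.sum_const, nsmul_eq_mul]
      push_cast
      ring
    rw [PiLp.inner_apply]
    have : ∀ x, inner ℂ (f x) (T f x) = if x ∈ B then ((-β * B.card : ℝ) : ℂ) else 0 := by
      intro x
      rw [RCLike.inner_apply]
      change T f x * (starRingEnd ℂ) (if x ∈ B then (1 : ℂ) else 0) = _
      split_ifs with hx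
      · rw [hTf x hx, map_one, mul_one]
      · rw [map_zero, mul_zero]
    simp only [this, Finset.sum_ite_mem, Finset.univ_inter, Finset.sum_const, nsmul_eq_mul]
    push_cast
    ring
  have hfinal : (β * B.card ^ 2) ^ 2 ≤ B.card * (μ * B.card) := by
    have h1 : ‖inner ℂ f (T f)‖ ≤ ‖f‖ * ‖T f‖ := norm_inner_le_norm f (T f)
    have h2 := hbound f
    rw [hinner, Complex.norm_real, Real.norm_eq_abs, neg_mul, abs_neg] at h1
    calc (β * B.card ^ 2) ^ 2 = |β * B.card ^ 2| ^ 2 := (sq_abs _).symm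
      _ ≤ (‖f‖ * ‖T f‖) ^ 2 := by gcongr
      _ = ‖f‖ ^ 2 * ‖T f‖ ^ 2 := by ring
      _ ≤ ‖f‖ ^ 2 * (μ * ‖f‖ ^ 2) := by gcongr
      _ = B.card * (μ * B.card) := by rw [hf]
  rcases B.eq_empty_or_nonempty with rfl | hne
  · simp; positivity
  have hb : (0 : ℝ) < B.card := by exact_mod_cast hne.card_pos
  have h1 : β ^ 2 * B.card ^ 2 ≤ μ := by
    have : β ^ 2 * B.card ^ 2 * (B.card : ℝ) ^ 2 ≤ μ * (B.card : ℝ) ^ 2 := by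
      nlinarith [hfinal]
    exact le_of_mul_le_mul_right this (by positivity)
  have h2 : β ^ 2 * (B.card : ℝ) ^ 2 * D ≤ n * B.card :=
    (mul_le_mul_of_nonneg_right h1 (Nat.cast_nonneg D)).trans hmain
  have h3 : (B.card : ℝ) * ((B.card : ℝ) ^ 3 * D) ≤ B.card * n ^ 3 := by
    have e : β ^ 2 * (B.card : ℝ) ^ 2 * D * n ^ 2 = B.card * ((B.card : ℝ) ^ 3 * D) := by
      rw [← hβn]; ring
    rw [← e]
    calc _ ≤ n * B.card * n ^ 2 := by gcongr
      _ = _ := by ring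
  exact le_of_mul_le_mul_left h3 hb

end FiniteGroup

/-! ### Product-free sets in profinite groups -/

section Compact

open MeasureTheory

theorem measureReal_eq_sum_inter_fiber {G : Type*} [MeasurableSpace G] {Q : Type*} [Fintype Q]
    (μ : Measure G) [IsFiniteMeasure μ] {π : G → Q} (hπ : ∀ q, MeasurableSet (π ⁻¹' {q}))
    {X : Set G} (hX : MeasurableSet X) :
    μ.real X = ∑ q, μ.real (X ∩ π ⁻¹' {q}) := by
  rw [← measureReal_biUnion_finset]
  · congr 1
    ext x
    simp
  · intro p _ q _ hpq
    refine Set.disjoint_left.mpr fun x hx hx' => hpq ?_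
    exact (show π x = p from hx.2).symm.trans hx'.2
  · exact fun q _ => hX.inter (hπ q)

variable {G : Type*} [Group G] [TopologicalSpace G] [IsTopologicalGroup G] [CompactSpace G]
  [MeasurableSpace G] [BorelSpace G]

instance normalizedHaar.isHaarMeasure : (normalizedHaar G).IsHaarMeasure :=
  Measure.isHaarMeasure_haarMeasure _

instance normalizedHaar.regular : (normalizedHaar G).Regular :=
  Measure.regular_haarMeasure

instance normalizedHaar.isProbabilityMeasure : IsProbabilityMeasure (normalizedHaar G) :=
  ⟨by
    have := Measure.haarMeasure_self (K₀ := (⊤ : TopologicalSpace.PositiveCompacts G))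
    rwa [TopologicalSpace.PositiveCompacts.coe_top] at this⟩

theorem normalizedHaar_real_preimage_mul (g : G) (X : Set G) :
    (normalizedHaar G).real ((fun h => g * h) ⁻¹' X) = (normalizedHaar G).real X := by
  rw [Measure.real, Measure.real, measure_preimage_mul]

/-- The upper bound for the product-free measure of a profinite group whose non-trivial continuous
representations have dimension at least `D`. Given a compact product-free set `K`, the cosets of a
small open normal subgroup more than half of which lie in `K` form a product-free subset of the
finite quotient, of density close to the measure of `K`. -/
theorem measureReal_le_of_productFree [TotallyDisconnectedSpace G] [T2Space G] {D : ℕ} (hD0 : 0 < D)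
    (hD : ∀ (d : ℕ) (ρ : G →* GL (Fin d) ℂ), Continuous ρ → ρ ≠ 1 → D ≤ d)
    {A : Set G} (hA : MeasurableSet A) (hfree : A ∩ (A * A) = ∅) :
    (normalizedHaar G).real A ≤ 1 / (D : ℝ) ^ ((1 : ℝ) / 3) := by
  classical
  set μ := normalizedHaar G
  have hDpos : (0 : ℝ) < D := by exact_mod_cast hD0
  refine le_of_forall_pos_le_add fun ε hε => ?_
  -- approximation of `A` by a compact set from inside, and of that by an open set from outside
  obtain ⟨K, hKA, hK, hKμ⟩ : ∃ K ⊆ A, IsCompact K ∧ μ.real A < μ.real K + ε / 2 := by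
    obtain ⟨K, hKA, hK, h⟩ := hA.exists_isCompact_lt_add (μ := μ) (measure_ne_top μ A)
      (ε := ENNReal.ofReal (ε / 2)) (by simpa using hε)
    refine ⟨K, hKA, hK, ?_⟩
    rw [Measure.real, Measure.real, ← ENNReal.toReal_ofReal (show 0 ≤ ε / 2 by positivity),
      ← ENNReal.toReal_add (measure_ne_top _ _) ENNReal.ofReal_ne_top]
    exact (ENNReal.toReal_lt_toReal (measure_ne_top _ _)
      (ENNReal.add_ne_top.mpr ⟨measure_ne_top _ _, ENNReal.ofReal_ne_top⟩)).mpr h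
  obtain ⟨U, hKU, hU, hUμ⟩ : ∃ U ⊇ K, IsOpen U ∧ μ.real U < μ.real K + ε / 2 := by
    obtain ⟨U, hKU, hU, h⟩ := K.exists_isOpen_lt_add (μ := μ) (measure_ne_top μ K)
      (ε := ENNReal.ofReal (ε / 2)) (by simpa using hε)
    refine ⟨U, hKU, hU, ?_⟩
    rw [Measure.real, Measure.real, ← ENNReal.toReal_ofReal (show 0 ≤ ε / 2 by positivity),
      ← ENNReal.toReal_add (measure_ne_top _ _) ENNReal.ofReal_ne_top]
    exact (ENNReal.toReal_lt_toReal (measure_ne_top _ _)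
      (ENNReal.add_ne_top.mpr ⟨measure_ne_top _ _, ENNReal.ofReal_ne_top⟩)).mpr h
  have hKmeas : MeasurableSet K := hK.isClosed.measurableSet
  obtain ⟨W, hW, hKW⟩ := compact_open_separated_mul_right hK hU hKU
  obtain ⟨W', hW'W, hW', h1W'⟩ := mem_nhds_iff.mp hW
  obtain ⟨H, hH⟩ := ProfiniteGrp.exist_openNormalSubgroup_sub_open_nhds_of_one hW' h1W'
  let N : Subgroup G := H.toSubgroup
  have hNopen : IsOpen (N : Set G) := H.isOpen'
  have hNn : N.Normal := H.isNormal'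
  have hfin : Finite (G ⧸ N) := N.quotient_finite_of_isOpen hNopen
  let Q := G ⧸ N
  let : Fintype Q := Fintype.ofFinite Q
  have hdisc : DiscreteTopology Q := QuotientGroup.discreteTopology hNopen
  let π : G →* Q := QuotientGroup.mk' N
  have hπc : Continuous π := continuous_quotient_mk'
  have hfib : ∀ q : Q, MeasurableSet (π ⁻¹' {q}) := fun q =>
    ((isOpen_discrete {q}).preimage hπc).measurableSet
  set n : ℝ := (Fintype.card Q : ℝ) with hn
  have hn0 : 0 < n := by rw [hn]; exact_mod_cast Fintype.card_pos
  have hshift : ∀ (a : G) (q : Q), (fun h => a * h) ⁻¹' (π ⁻¹' {π a * q}) = π ⁻¹' {q} := by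
    intro a q
    ext h
    simp
  set ν := μ.real (π ⁻¹' {1}) with hν
  have hfibν : ∀ q : Q, μ.real (π ⁻¹' {q}) = ν := by
    intro q
    obtain ⟨a, rfl⟩ := QuotientGroup.mk'_surjective N q
    have := hshift a 1
    rw [mul_one] at this
    rw [hν, ← this]
    exact (normalizedHaar_real_preimage_mul a _).symm
  have hnν : n * ν = 1 := by
    have := measureReal_eq_sum_inter_fiber μ hfib MeasurableSet.univ
    simp only [Set.univ_inter, hfibν, Finset.sum_const, Finset.card_univ, nsmul_eq_mul] at this
    rw [← hn] at this
    rw [← this]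
    simp
  have hν0 : 0 < ν := by
    by_contra h
    nlinarith
  let B : Finset Q := Finset.univ.filter fun q => ν / 2 < μ.real (K ∩ π ⁻¹' {q})
  have hB : ∀ q, q ∈ B ↔ ν / 2 < μ.real (K ∩ π ⁻¹' {q}) := fun q => by simp [B]
  have hBfree : ∀ p ∈ B, ∀ q ∈ B, p * q ∉ B := by
    intro p hp q hq hpq
    rw [hB] at hp hq hpq
    obtain ⟨a, haK, hap⟩ : (K ∩ π ⁻¹' {p}).Nonempty := by
      by_contra h
      rw [Set.not_nonempty_iff_eq_empty] at h
      rw [h, measureReal_empty] at hp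
      linarith
    have hap' : π a = p := hap
    subst hap'
    -- `K ∩ q` and the translate by `a⁻¹` of `K ∩ p q` fill more than half of the coset `q`
    let Y := (fun h => a * h) ⁻¹' (K ∩ π ⁻¹' {π a * q})
    have hYμ : μ.real Y = μ.real (K ∩ π ⁻¹' {π a * q}) := normalizedHaar_real_preimage_mul a _
    have hYsub : Y ⊆ π ⁻¹' {q} := by
      rw [← hshift a q]
      exact Set.preimage_mono Set.inter_subset_right
    have hYmeas : MeasurableSet Y := measurable_const_mul a (hKmeas.inter (hfib _))
    obtain ⟨b, hbK, hbY⟩ : ((K ∩ π ⁻¹' {q}) ∩ Y).Nonempty := by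
      by_contra h
      have hdisj : Disjoint (K ∩ π ⁻¹' {q}) Y := by
        rw [Set.disjoint_iff_inter_eq_empty]
        exact Set.not_nonempty_iff_eq_empty.mp h
      have h1 := measureReal_union (μ := μ) hdisj hYmeas
      have h2 : μ.real ((K ∩ π ⁻¹' {q}) ∪ Y) ≤ ν := by
        rw [← hfibν q]
        exact measureReal_mono (Set.union_subset Set.inter_subset_right hYsub)
      linarith
    have : a * b ∈ A ∩ (A * A) :=
      ⟨hKA hbY.1, Set.mul_mem_mul (hKA haK) (hKA hbK.1)⟩
    rw [hfree] at this
    exact this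
  have hbound := card_pow_three_mul_le (Q := Q) (D := D) (fun d ρ hρ => by
    have hρc : Continuous ρ := continuous_of_discreteTopology
    exact hD d (ρ.comp π) (hρc.comp hπc) fun h => hρ (QuotientGroup.monoidHom_ext N h)) B hBfree
  have hKle : μ.real K ≤ (μ.real U + B.card * ν) / 2 := by
    have e : (B.card : ℝ) * ν = ∑ q, if q ∈ B then ν else 0 := by
      rw [Finset.sum_ite_mem, Finset.univ_inter, Finset.sum_const, nsmul_eq_mul]
    rw [measureReal_eq_sum_inter_fiber μ hfib hKmeas,
      measureReal_eq_sum_inter_fiber μ hfib hU.measurableSet, e, ← Finset.sum_add_distrib,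
      Finset.sum_div]
    refine Finset.sum_le_sum fun q _ => ?_
    have hle : μ.real (K ∩ π ⁻¹' {q}) ≤ ν := by
      rw [← hfibν q]; exact measureReal_mono Set.inter_subset_right
    by_cases hq : (K ∩ π ⁻¹' {q}).Nonempty
    · have hUq : μ.real (U ∩ π ⁻¹' {q}) = ν := by
        rw [← hfibν q, Set.inter_eq_right.mpr]
        obtain ⟨a, haK, ha⟩ := hq
        intro x hx
        apply hKW
        refine ⟨a, haK, a⁻¹ * x, hW'W (hH ?_), by simp⟩
        change a⁻¹ * x ∈ N
        rw [← QuotientGroup.eq]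
        exact (show π a = q from ha).trans (show π x = q from hx).symm
      rw [hUq]
      split_ifs with h
      · linarith
      · rw [hB, not_lt] at h
        linarith
    · rw [Set.not_nonempty_iff_eq_empty.mp hq, measureReal_empty]
      split_ifs <;> positivity
  have hβ : (B.card : ℝ) * ν ≤ 1 / (D : ℝ) ^ ((1 : ℝ) / 3) := by
    have h0 : (0 : ℝ) ≤ B.card * ν := by positivity
    have h1 : ((B.card : ℝ) * ν) ^ 3 ≤ 1 / D := by
      rw [le_div_iff₀ hDpos]
      calc ((B.card : ℝ) * ν) ^ 3 * D = (B.card : ℝ) ^ 3 * D * ν ^ 3 := by ring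
        _ ≤ n ^ 3 * ν ^ 3 := by gcongr
        _ = 1 := by rw [← mul_pow, hnν, one_pow]
    calc (B.card : ℝ) * ν = (((B.card : ℝ) * ν) ^ 3) ^ ((1 : ℝ) / 3) := by
          rw [← Real.rpow_natCast, ← Real.rpow_mul h0]; norm_num
      _ ≤ (1 / (D : ℝ)) ^ ((1 : ℝ) / 3) := by gcongr
      _ = 1 / (D : ℝ) ^ ((1 : ℝ) / 3) := by
          rw [Real.div_rpow zero_le_one hDpos.le, Real.one_rpow]
  linarith

end Compact

/-! ### Automorphisms permuting the children of vertices -/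

section TreeAutomorphisms

open TreeVertex

variable {k : ℕ}

theorem rootedAut.depth_apply (x : rootedAut k) (v : TreeVertex k) : (x.1 v).depth = v.depth := by
  rw [← regTree.dist_root, ← regTree.dist_root, rootedAut.dist_apply]

theorem rootedAut.isParent_apply (x : rootedAut k) {u v : TreeVertex k} (h : u.IsParent v) :
    (x.1 u).IsParent (x.1 v) := by
  have hadj : (regTree k).Adj (x.1 u) (x.1 v) := x.1.map_rel_iff.mpr (Or.inl h)
  rcases hadj with h' | h'
  · exact h'
  · have h1 := h.depth_eq
    have h2 := h'.depth_eq
    rw [rootedAut.depth_apply, rootedAut.depth_apply] at h2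
    omega

theorem rootedAut.ext_apply {x y : rootedAut k} (h : ∀ v, x.1 v = y.1 v) : x = y :=
  Subtype.ext (RelIso.ext h)

/-- An action of a group on the vertices that fixes the root and preserves the parent relation
gives a homomorphism to the group of rooted automorphisms. -/
def rootedAutHom {H : Type*} [Group H] (f : H → TreeVertex k → TreeVertex k) (h1 : ∀ v, f 1 v = v)
    (hmul : ∀ g h v, f (g * h) v = f g (f h v)) (hroot : ∀ g, f g root = root)
    (hpar : ∀ g u v, u.IsParent v → (f g u).IsParent (f g v)) : H →* rootedAut k :=
  have hinv : ∀ g v, f g⁻¹ (f g v) = v := fun g v => by rw [← hmul, inv_mul_cancel, h1]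
  have hadj : ∀ g u v, (regTree k).Adj u v → (regTree k).Adj (f g u) (f g v) := fun g u v h =>
    h.imp (hpar g u v) (hpar g v u)
  { toFun := fun g =>
      ⟨{ toFun := f g
         invFun := f g⁻¹
         left_inv := hinv g
         right_inv := fun v => by rw [← hmul, mul_inv_cancel, h1]
         map_rel_iff' := fun {u v} => ⟨fun h => by
            have := hadj g⁻¹ _ _ h
            exact (hinv g u) ▸ (hinv g v) ▸ this, hadj g u v⟩ }, hroot g⟩
    map_one' := rootedAut.ext_apply h1
    map_mul' := fun g h => rootedAut.ext_apply (hmul g h) }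

/-- The permutations of the first steps, acting rigidly on the subtrees below the root. -/
def rootPerm (k : ℕ) : Equiv.Perm (Fin (k + 1)) →* rootedAut k :=
  rootedAutHom
    (fun π v => match v with
      | root => root
      | node i w => node (π i) w)
    (fun v => by cases v <;> rfl) (fun _ _ v => by cases v <;> rfl) (fun _ => rfl)
    (fun π u v h => by
      cases h with
      | first i => exact IsParent.first _
      | later i w a => exact IsParent.later _ _ _)

theorem rootPerm_node (π : Equiv.Perm (Fin (k + 1))) (i : Fin (k + 1)) (w : List (Fin k)) :
    (rootPerm k π).1 (node i w) = node (π i) w := rfl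

/-- The permutations `p w` applied to the step that follows the path `w`, for the paths `w` of
length `m` only. -/
def permStep (m : ℕ) (p : List (Fin k) → Equiv.Perm (Fin k)) : List (Fin k) → List (Fin k)
  | [] => []
  | a :: w => (if w.length = m then p w a else a) :: permStep m p w

theorem length_permStep (m : ℕ) (p : List (Fin k) → Equiv.Perm (Fin k)) (w : List (Fin k)) :
    (permStep m p w).length = w.length := by
  induction w with
  | nil => rfl
  | cons a w ih => simp [permStep, ih]

theorem permStep_of_length_le {m : ℕ} (p : List (Fin k) → Equiv.Perm (Fin k)) {w : List (Fin k)}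
    (h : w.length ≤ m) : permStep m p w = w := by
  induction w with
  | nil => rfl
  | cons a w ih =>
    simp only [List.length_cons] at h
    rw [permStep, ih (by omega), if_neg (by omega)]

theorem permStep_one (m : ℕ) (w : List (Fin k)) : permStep m 1 w = w := by
  induction w with
  | nil => rfl
  | cons a w ih => rw [permStep, ih]; simp

theorem permStep_mul (m : ℕ) (p q : List (Fin k) → Equiv.Perm (Fin k)) (w : List (Fin k)) :
    permStep m (p * q) w = permStep m p (permStep m q w) := by
  induction w with
  | nil => rfl
  | cons a w ih =>
    simp only [permStep, length_permStep, ih]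
    split_ifs with h
    · rw [permStep_of_length_le q h.le]; rfl
    · rfl

theorem permStep_permStep {m n : ℕ} (h : n < m) (p q q' : List (Fin k) → Equiv.Perm (Fin k))
    (hq : ∀ u, q' (permStep n p u) = q u) (w : List (Fin k)) :
    permStep n p (permStep m q w) = permStep m q' (permStep n p w) := by
  induction w with
  | nil => rfl
  | cons a w ih =>
    simp only [permStep, length_permStep, ih]
    by_cases h1 : w.length = n
    · rw [if_pos h1, if_neg (by omega), if_neg (by omega), if_pos h1,
        permStep_of_length_le q (by omega)]
    · simp only [if_neg h1, hq]

/-- The automorphisms that permute the children of each vertex `node i w` with `w` of length `m` by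
a permutation `P (i, w)`, the subtrees below these children being moved rigidly. -/
def levelPerm (k m : ℕ) : (Fin (k + 1) × List (Fin k) → Equiv.Perm (Fin k)) →* rootedAut k :=
  rootedAutHom
    (fun P v => match v with
      | root => root
      | node i w => node i (permStep m (fun u => P (i, u)) w))
    (fun v => by
      cases v with
      | root => rfl
      | node i w => exact congrArg (node i) (permStep_one m w))
    (fun P Q v => by
      cases v with
      | root => rfl
      | node i w => exact congrArg (node i) (permStep_mul m _ _ w))
    (fun _ => rfl)
    (fun P u v h => by
      cases h with
      | first i => exact IsParent.first _
      | later i w a => exact IsParent.later _ _ _)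

theorem levelPerm_node (m : ℕ) (P : Fin (k + 1) × List (Fin k) → Equiv.Perm (Fin k))
    (i : Fin (k + 1)) (w : List (Fin k)) :
    (levelPerm k m P).1 (node i w) = node i (permStep m (fun u => P (i, u)) w) := rfl

theorem rootPerm_mul_levelPerm (m : ℕ) (π : Equiv.Perm (Fin (k + 1)))
    (P P' : Fin (k + 1) × List (Fin k) → Equiv.Perm (Fin k)) (h : ∀ i u, P' (π i, u) = P (i, u)) :
    rootPerm k π * levelPerm k m P = levelPerm k m P' * rootPerm k π := by
  apply rootedAut.ext_apply
  intro v
  cases v with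
  | root => rfl
  | node i w =>
    change node (π i) (permStep m (fun u => P (i, u)) w) =
      node (π i) (permStep m (fun u => P' (π i, u)) w)
    simp only [h]

theorem levelPerm_mul_levelPerm {m n : ℕ} (hnm : n < m)
    (R P P' : Fin (k + 1) × List (Fin k) → Equiv.Perm (Fin k))
    (h : ∀ i u, P' (i, permStep n (fun t => R (i, t)) u) = P (i, u)) :
    levelPerm k n R * levelPerm k m P = levelPerm k m P' * levelPerm k n R := by
  apply rootedAut.ext_apply
  intro v
  cases v with
  | root => rfl
  | node i w => exact congrArg (node i) (permStep_permStep hnm _ _ _ (h i) w)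

theorem rootPerm_conj_mulSingle (m : ℕ) (π : Equiv.Perm (Fin (k + 1))) (i : Fin (k + 1))
    (u : List (Fin k)) (σ : Equiv.Perm (Fin k)) :
    rootPerm k π * levelPerm k m (Pi.mulSingle (i, u) σ) * (rootPerm k π)⁻¹ =
      levelPerm k m (Pi.mulSingle (π i, u) σ) := by
  rw [mul_inv_eq_iff_eq_mul]
  apply rootPerm_mul_levelPerm
  intro j t
  by_cases h : (j, t) = (i, u)
  · obtain ⟨rfl, rfl⟩ := Prod.mk.inj h
    rw [Pi.mulSingle_eq_same, Pi.mulSingle_eq_same]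
  · rw [Pi.mulSingle_eq_of_ne h, Pi.mulSingle_eq_of_ne]
    intro h'
    obtain ⟨h1, rfl⟩ := Prod.mk.inj h'
    exact h (by rw [π.injective h1])

theorem permStep_injective (m : ℕ) (p : List (Fin k) → Equiv.Perm (Fin k)) :
    Function.Injective (permStep m p) := by
  intro u v h
  have := congrArg (permStep m p⁻¹) h
  rwa [← permStep_mul, ← permStep_mul, inv_mul_cancel, permStep_one, permStep_one] at this

theorem levelPerm_conj_mulSingle {m n : ℕ} (hnm : n < m)
    (R : Fin (k + 1) × List (Fin k) → Equiv.Perm (Fin k)) (i : Fin (k + 1))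
    (u : List (Fin k)) (σ : Equiv.Perm (Fin k)) :
    levelPerm k n R * levelPerm k m (Pi.mulSingle (i, u) σ) * (levelPerm k n R)⁻¹ =
      levelPerm k m (Pi.mulSingle (i, permStep n (fun t => R (i, t)) u) σ) := by
  rw [mul_inv_eq_iff_eq_mul]
  apply levelPerm_mul_levelPerm hnm
  intro j t
  by_cases h : (j, t) = (i, u)
  · obtain ⟨rfl, rfl⟩ := Prod.mk.inj h
    rw [Pi.mulSingle_eq_same, Pi.mulSingle_eq_same]
  · rw [Pi.mulSingle_eq_of_ne h, Pi.mulSingle_eq_of_ne]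
    intro h'
    obtain ⟨rfl, h2⟩ := Prod.mk.inj h'
    exact h (by rw [permStep_injective _ _ h2])

theorem permStep_append {n : ℕ} (p : List (Fin k) → Equiv.Perm (Fin k)) (w₁ : List (Fin k))
    (a : Fin k) {w₂ : List (Fin k)} (h : w₂.length = n) :
    permStep n p (w₁ ++ a :: w₂) = w₁ ++ p w₂ a :: w₂ := by
  induction w₁ with
  | nil => rw [List.nil_append, List.nil_append, permStep, if_pos h, permStep_of_length_le p h.le]
  | cons b w ih =>
    rw [List.cons_append, permStep, ih, if_neg, List.cons_append]
    simp only [List.length_append, List.length_cons]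
    omega

end TreeAutomorphisms

/-! ### Positive automorphisms -/

section Positive

open TreeVertex

variable {k : ℕ}

theorem mem_positiveAut {x : rootedAut k} :
    x ∈ positiveAut k ↔ ∀ j, 1 ≤ j → Equiv.Perm.sign (sphereAction k j x) = 1 := by
  simp [positiveAut, Subgroup.mem_iInf, MonoidHom.mem_ker]

theorem alternatingGroup_hom_eq_one {α : Type*} [Fintype α] [DecidableEq α]
    (h5 : 5 ≤ Fintype.card α) {C : Type*} [CommGroup C] (f : alternatingGroup α →* C) (σ) :
    f σ = 1 := by
  have h : σ ∈ commutator (alternatingGroup α) := by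
    rw [commutator_alternatingGroup_eq_top (by simpa using h5)]; trivial
  exact MonoidHom.mem_ker.mp (Abelianization.commutator_subset_ker f h)

/-- As alternating groups are perfect, their images consist of positive automorphisms. -/
theorem map_alternatingGroup_mem_positiveAut {α : Type*} [Fintype α] [DecidableEq α]
    (h5 : 5 ≤ Fintype.card α) (f : alternatingGroup α →* rootedAut k) (σ) :
    f σ ∈ positiveAut k := by
  rw [mem_positiveAut]
  intro j _
  exact alternatingGroup_hom_eq_one h5
    ((Equiv.Perm.sign.comp (sphereAction k j)).comp f) σ

theorem mul_conj_mem_positiveAut {x : rootedAut k} (hx : x * x = 1) (g : rootedAut k) :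
    x * (g * x * g⁻¹) ∈ positiveAut k := by
  rw [mem_positiveAut]
  intro j _
  have h : ∀ f : rootedAut k →* ℤˣ, f (x * (g * x * g⁻¹)) = 1 := by
    intro f
    rw [map_mul, map_mul, map_mul, map_inv, mul_comm (f g), mul_inv_cancel_right, ← map_mul, hx,
      map_one]
  exact h (Equiv.Perm.sign.comp (sphereAction k j))

end Positive

/-! ### Subgroups normalized by the positive automorphisms -/

section NormalSubgroups

open TreeVertex Equiv

variable {k : ℕ} {L : Subgroup (rootedAut k)}

theorem exists_three_others (hk : 6 ≤ k) (i : Fin (k + 1)) :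
    ∃ a b c : Fin (k + 1), a ≠ i ∧ b ≠ i ∧ c ≠ i ∧ a ≠ b ∧ a ≠ c ∧ b ≠ c := by
  obtain ⟨s, hs, hcard⟩ := Finset.exists_subset_card_eq (s := Finset.univ.erase i) (n := 3) (by
    rw [Finset.card_erase_of_mem (Finset.mem_univ i), Finset.card_univ, Fintype.card_fin]; omega)
  obtain ⟨a, b, c, hab, hac, hbc, rfl⟩ := Finset.card_eq_three.mp hcard
  exact ⟨a, b, c, Finset.ne_of_mem_erase (hs (by simp)), Finset.ne_of_mem_erase (hs (by simp)),
    Finset.ne_of_mem_erase (hs (by simp)), hab, hac, hbc⟩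

/-- Let `L` be a subgroup that is normalized by the positive automorphisms and contains the even
permutations of the branches at the root. An even permutation of the children of a vertex lies in
`L`: modulo `L`, the permutations at a
vertex agree with those at the corresponding vertex below another child of the root, with which
they commute; hence the commutators of these permutations lie in `L`, and the alternating group is
perfect. -/
theorem levelPerm_mulSingle_mem (hk : 6 ≤ k)
    (hnorm : ∀ x ∈ L, ∀ g ∈ positiveAut k, g * x * g⁻¹ ∈ L)
    (hroot : ∀ σ ∈ alternatingGroup (Fin (k + 1)), rootPerm k σ ∈ L) (m : ℕ)
    (v : Fin (k + 1) × List (Fin k)) {σ : Perm (Fin k)} (hσ : σ ∈ alternatingGroup (Fin k)) :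
    levelPerm k m (Pi.mulSingle v σ) ∈ L := by
  obtain ⟨i, u⟩ := v
  let h : Fin (k + 1) → Perm (Fin k) →* rootedAut k := fun i =>
    (levelPerm k m).comp
      (MonoidHom.mulSingle (fun _ : Fin (k + 1) × List (Fin k) => Perm (Fin k)) (i, u))
  have hh : ∀ i σ, h i σ = levelPerm k m (Pi.mulSingle (i, u) σ) := fun _ _ => rfl
  let f : alternatingGroup (Fin k) →* rootedAut k := (h i).comp (alternatingGroup (Fin k)).subtype
  obtain ⟨a, b, c, hai, hbi, hci, hab, hac, hbc⟩ := exists_three_others hk i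
  suffices hS : L.comap f = ⊤ from (hS ▸ Subgroup.mem_top (⟨σ, hσ⟩ : alternatingGroup (Fin k)) :
    (⟨σ, hσ⟩ : alternatingGroup (Fin k)) ∈ L.comap f)
  rw [eq_top_iff, ← commutator_alternatingGroup_eq_top (α := Fin k) (by simp; omega),
    commutator_def, Subgroup.commutator_le]
  intro σ₁ _ σ₂ _
  let τ : Perm (Fin (k + 1)) := swap i a * swap b c
  have hτ : rootPerm k τ ∈ L := hroot τ (swap_mul_swap_mem_alternatingGroup hai.symm hbc)
  have hτi : τ i = a := by simp [τ, swap_apply_of_ne_of_ne hbi.symm hci.symm]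
  set x := f σ₁ with hx
  set y := f σ₂ with hy
  have hxp : x ∈ positiveAut k := map_alternatingGroup_mem_positiveAut (by simp; omega) f σ₁
  have hyp : y ∈ positiveAut k := map_alternatingGroup_mem_positiveAut (by simp; omega) f σ₂
  set z := rootPerm k τ * y * (rootPerm k τ)⁻¹ with hz
  have hz' : z = h a σ₂.1 := by
    rw [hz, hh, ← hτi]
    exact rootPerm_conj_mulSingle m τ i u σ₂.1
  have hcomm : Commute x z := by
    rw [hz']
    exact (Pi.mulSingle_commute (fun e => hai (Prod.mk.inj e).1.symm) σ₁.1 σ₂.1).map (levelPerm k m)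
  have hl : y * z⁻¹ ∈ L := by
    have : y * z⁻¹ = (y * rootPerm k τ * y⁻¹) * (rootPerm k τ)⁻¹ := by rw [hz]; group
    rw [this]
    exact L.mul_mem (hnorm _ hτ y hyp) (L.inv_mem hτ)
  change f (σ₁ * σ₂ * σ₁⁻¹ * σ₂⁻¹) ∈ L
  have : f (σ₁ * σ₂ * σ₁⁻¹ * σ₂⁻¹) = (x * (y * z⁻¹) * x⁻¹) * (y * z⁻¹)⁻¹ := by
    rw [map_mul, map_mul, map_mul, map_inv, map_inv, ← hx, ← hy]
    have e : z⁻¹ * x⁻¹ * z = x⁻¹ := by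
      rw [mul_assoc, mul_eq_of_eq_inv_mul]
      rw [inv_inv]
      exact hcomm.inv_left.eq
    calc x * y * x⁻¹ * y⁻¹ = x * y * (z⁻¹ * x⁻¹ * z) * y⁻¹ := by rw [e]
      _ = _ := by group
  rw [this]
  exact L.mul_mem (hnorm _ hl x hxp) (L.inv_mem hl)

theorem mulSingle_mul_self_eq_one (v : Fin (k + 1) × List (Fin k)) {τ : Perm (Fin k)}
    (hτ : τ * τ = 1) :
    (Pi.mulSingle v τ : Fin (k + 1) × List (Fin k) → Perm (Fin k)) * Pi.mulSingle v τ = 1 := by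
  rw [← Pi.mulSingle_mul, hτ, Pi.mulSingle_one]

/-- If conjugation by `a ∈ L` takes the involution `x` to `x'` and fixes a conjugate `y` of `x`, then
`x' * x` is in `L`: it is the commutator of `a` with the positive automorphism `x * y`. -/
theorem levelPerm_mul_mem_of_conj (hnorm : ∀ x ∈ L, ∀ g ∈ positiveAut k, g * x * g⁻¹ ∈ L)
    {x x' y a g : rootedAut k} (hx : x * x = 1)
    (hg : g * x * g⁻¹ = y) (ha : a ∈ L) (hax : a * x * a⁻¹ = x') (hay : a * y * a⁻¹ = y) :
    x' * x ∈ L := by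
  have hp : x * y ∈ positiveAut k := hg ▸ mul_conj_mem_positiveAut hx g
  have h1 := L.mul_mem ha (L.inv_mem (hnorm a ha (x * y) hp))
  have : a * (x * y * a * (x * y)⁻¹)⁻¹ = x' * x := by
    have hxi : x⁻¹ = x := inv_eq_of_mul_eq_one_left hx
    calc a * (x * y * a * (x * y)⁻¹)⁻¹ = (a * x * a⁻¹) * (a * y * a⁻¹) * y⁻¹ * x⁻¹ := by group
      _ = x' * x := by rw [hax, hay, hxi, mul_inv_cancel_right]
  rwa [this] at h1

/-- The product of the same involution at two vertices of the same level lies in `L`. -/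
theorem levelPerm_mulSingle_mul_mulSingle_mem (hk : 6 ≤ k)
    (hnorm : ∀ x ∈ L, ∀ g ∈ positiveAut k, g * x * g⁻¹ ∈ L)
    (hroot : ∀ σ ∈ alternatingGroup (Fin (k + 1)), rootPerm k σ ∈ L) {τ : Perm (Fin k)}
    (hτ : τ * τ = 1) (v v' : Fin (k + 1) × List (Fin k)) (hlen : v.2.length = v'.2.length) :
    levelPerm k v.2.length (Pi.mulSingle v τ * Pi.mulSingle v' τ) ∈ L := by
  obtain ⟨i, u⟩ := v
  obtain ⟨i', u'⟩ := v'
  simp only at hlen ⊢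
  obtain ⟨m, hm⟩ : ∃ m, u.length = m := ⟨_, rfl⟩
  rw [hm]
  rw [hm] at hlen
  let s : Fin (k + 1) × List (Fin k) → rootedAut k := fun v => levelPerm k m (Pi.mulSingle v τ)
  have hs2 : ∀ v, s v * s v = 1 := fun v => by
    simp only [s]; rw [← map_mul, mulSingle_mul_self_eq_one v hτ, map_one]
  have htrans : ∀ a b c, s a * s b ∈ L → s b * s c ∈ L → s a * s c ∈ L := by
    intro a b c h1 h2
    have := L.mul_mem h1 h2
    rwa [mul_assoc, ← mul_assoc (s b), hs2, one_mul] at this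
  have hconj : ∀ π i u, rootPerm k π * s (i, u) * (rootPerm k π)⁻¹ = s (π i, u) := fun π i u =>
    rootPerm_conj_mulSingle m π i u τ
  -- changing the first step
  have hfirst : ∀ i i' u, s (i', u) * s (i, u) ∈ L := by
    intro i i' u
    rcases eq_or_ne i' i with rfl | hne
    · rw [hs2]; exact L.one_mem
    obtain ⟨a, b, c, hai, hbi, hci, hab, hac, hbc⟩ := exists_three_others hk i
    obtain ⟨a, b, hai, hbi, hab, hai', hbi'⟩ : ∃ a b : Fin (k + 1), a ≠ i ∧ b ≠ i ∧ a ≠ b ∧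
        a ≠ i' ∧ b ≠ i' := by
      rcases eq_or_ne a i' with rfl | h1
      · exact ⟨b, c, hbi, hci, hbc, hab.symm, hac.symm⟩
      rcases eq_or_ne b i' with rfl | h2
      · exact ⟨a, c, hai, hci, hac, h1, hbc.symm⟩
      exact ⟨a, b, hai, hbi, hab, h1, h2⟩
    refine levelPerm_mul_mem_of_conj hnorm (y := s (b, u)) (a := rootPerm k (swap i a * swap i i'))
      (g := rootPerm k (swap i b)) (hs2 _) ?_
      (hroot _ (swap_mul_swap_mem_alternatingGroup hai.symm hne.symm)) ?_ ?_
    · rw [hconj, swap_apply_left]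
    · rw [hconj, Perm.mul_apply, swap_apply_left, swap_apply_of_ne_of_ne hne hai'.symm]
    · rw [hconj, Perm.mul_apply, swap_apply_of_ne_of_ne hbi hbi',
        swap_apply_of_ne_of_ne hbi hab.symm]
  -- changing a later step
  have hstep : ∀ i w₁ w₂ b b', w₁.length + w₂.length + 1 = m →
      s (i, w₁ ++ b' :: w₂) * s (i, w₁ ++ b :: w₂) ∈ L := by
    intro i w₁ w₂ b b' hl
    rcases eq_or_ne b' b with rfl | hne
    · rw [hs2]; exact L.one_mem
    obtain ⟨i', -, -, hi', -⟩ := exists_three_others hk i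
    obtain ⟨c, hc⟩ : ∃ c, c ∉ ({b, b'} : Finset (Fin k)) := by
      by_contra! h
      have h1 := Finset.card_le_card (fun x _ => h x : (Finset.univ : Finset (Fin k)) ⊆ _)
      have h2 := Finset.card_le_two (a := b) (b := b')
      rw [Finset.card_univ, Fintype.card_fin] at h1
      omega
    simp only [Finset.mem_insert, Finset.mem_singleton, not_or] at hc
    have hnm : w₂.length < m := by omega
    refine levelPerm_mul_mem_of_conj hnorm (y := s (i', w₁ ++ b :: w₂))
      (a := levelPerm k w₂.length (Pi.mulSingle (i, w₂) (swap b c * swap b b')))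
      (g := rootPerm k (swap i i')) (hs2 _) ?_
      (levelPerm_mulSingle_mem hk hnorm hroot _ _
        (swap_mul_swap_mem_alternatingGroup (Ne.symm hc.1) hne.symm)) ?_ ?_
    · rw [hconj, swap_apply_left]
    · refine (levelPerm_conj_mulSingle hnm _ _ _ _).trans ?_
      rw [permStep_append _ _ _ rfl, Pi.mulSingle_eq_same, Perm.mul_apply, swap_apply_left,
        swap_apply_of_ne_of_ne hne (Ne.symm hc.2)]
    · refine (levelPerm_conj_mulSingle hnm _ _ _ _).trans ?_
      rw [permStep_append _ _ _ rfl, Pi.mulSingle_eq_of_ne (fun e => hi' (Prod.mk.inj e).1)]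
      rfl
  have hlater : ∀ i w₂ w₂', w₂.length = w₂'.length → ∀ w₁,
      w₁.length + w₂.length = m → s (i, w₁ ++ w₂) * s (i, w₁ ++ w₂') ∈ L := by
    intro i w₂
    induction w₂ with
    | nil =>
      intro w₂' h w₁ hl
      rw [List.length_eq_zero_iff.mp h.symm, hs2]
      exact L.one_mem
    | cons b w₂ ih =>
      intro w₂' h w₁ hl
      cases w₂' with
      | nil => simp at h
      | cons b' w₂' =>
        refine htrans _ _ _ (hstep i w₁ w₂ b' b (by simpa [add_assoc] using hl)) ?_
        have := ih w₂' (by simpa using h) (w₁ ++ [b']) (by simp at hl ⊢; omega)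
        simpa using this
  rw [map_mul]
  exact htrans _ _ _ (hfirst i' i u) (hlater i' u u' (hm.trans hlen) [] (by simpa using hm))

end NormalSubgroups

/-! ### Automorphisms permuting the children of one level -/

section LevelPermutations

open TreeVertex Equiv

variable {k : ℕ} {L : Subgroup (rootedAut k)}

theorem levelPerm_node_cons {m : ℕ} (P : Fin (k + 1) × List (Fin k) → Perm (Fin k))
    (i : Fin (k + 1)) (a : Fin k) {w : List (Fin k)} (hw : w.length = m) :
    (levelPerm k m P).1 (node i (a :: w)) = node i (P (i, w) a :: w) := by
  rw [levelPerm_node]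
  exact congrArg (node i) (permStep_append _ [] a hw)

theorem levelPerm_of_depth_le {m : ℕ} (P : Fin (k + 1) × List (Fin k) → Perm (Fin k))
    {v : TreeVertex k} (hv : v.depth ≤ m + 1) : (levelPerm k m P).1 v = v := by
  cases v with
  | root => rfl
  | node i w =>
    rw [levelPerm_node, permStep_of_length_le _ (by simpa [depth] using hv)]

/-- A transposition of the children of a vertex transposes two vertices of the sphere that contains
these children. -/
theorem sign_sphereAction_levelPerm_mulSingle_swap (v : Fin (k + 1) × List (Fin k)) {a b : Fin k}
    (hab : a ≠ b) :
    Perm.sign (sphereAction k (v.2.length + 2)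
      (levelPerm k v.2.length (Pi.mulSingle v (swap a b)))) = -1 := by
  obtain ⟨i, u⟩ := v
  simp only
  have hc : ∀ c, (regTree k).dist root (node i (c :: u)) = u.length + 2 := fun c => by
    rw [regTree.dist_root]; rfl
  have : sphereAction k (u.length + 2) (levelPerm k u.length (Pi.mulSingle (i, u) (swap a b))) =
      swap (⟨node i (a :: u), hc a⟩ : treeSphere k (u.length + 2)) ⟨node i (b :: u), hc b⟩ := by
    ext ⟨x, hx⟩
    rw [regTree.dist_root] at hx
    change (levelPerm k u.length (Pi.mulSingle (i, u) (swap a b))).1 x = _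
    rw [swap_apply_def]
    match x, hx with
    | node j [], hx => simp [depth] at hx
    | node j (c :: w), hx =>
      rw [levelPerm_node_cons _ _ _ (by simpa [depth] using hx)]
      by_cases h : (j, w) = (i, u)
      · obtain ⟨rfl, rfl⟩ := Prod.mk.inj h
        rw [Pi.mulSingle_eq_same, swap_apply_def]
        simp only [Subtype.mk.injEq, node.injEq, List.cons.injEq, true_and, and_true]
        split_ifs <;> rfl
      · rw [Pi.mulSingle_eq_of_ne h]
        rw [Prod.mk.injEq] at h
        simp only [Subtype.mk.injEq, node.injEq, List.cons.injEq]
        rw [if_neg (by tauto), if_neg (by tauto)]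
        rfl
  rw [this, Perm.sign_swap]
  simpa using hab

theorem mul_swap_mem_alternatingGroup {α : Type*} [Fintype α] [DecidableEq α] {σ : Perm α}
    {a b : α} (hab : a ≠ b) (hσ : σ ∉ alternatingGroup α) : σ * swap a b ∈ alternatingGroup α := by
  rw [Perm.mem_alternatingGroup] at hσ ⊢
  rw [map_mul, Perm.sign_swap hab, (Int.units_eq_one_or _).resolve_left hσ]
  rfl

/-- Modulo `L`, permutations of the children of the vertices of a level can be moved to one of
these vertices. -/
theorem exists_levelPerm_mulSingle_mul_mem (hk : 6 ≤ k)
    (hnorm : ∀ x ∈ L, ∀ g ∈ positiveAut k, g * x * g⁻¹ ∈ L)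
    (hroot : ∀ σ ∈ alternatingGroup (Fin (k + 1)), rootPerm k σ ∈ L)
    (v : Fin (k + 1) × List (Fin k)) (J : Finset (Fin (k + 1) × List (Fin k))) :
    v ∉ J → (∀ w ∈ J, w.2.length = v.2.length) →
    ∀ P : Fin (k + 1) × List (Fin k) → Perm (Fin k), (∀ w, w ∉ J → P w = 1) →
      ∃ e, levelPerm k v.2.length (Pi.mulSingle v e * P) ∈ L := by
  classical
  induction J using Finset.induction_on with
  | empty =>
    intro _ _ P hP
    refine ⟨1, ?_⟩
    rw [show P = 1 from funext fun w => hP w (Finset.notMem_empty w), Pi.mulSingle_one, mul_one,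
      map_one]
    exact L.one_mem
  | insert w J hwJ ih =>
    intro hv hlen P hP
    rw [Finset.mem_insert, not_or] at hv
    obtain ⟨e, he⟩ := ih hv.2 (fun w' h => hlen w' (Finset.mem_insert_of_mem h))
      (Function.update P w 1) (fun w' h => by
        rcases eq_or_ne w' w with rfl | hne
        · rw [Function.update_self]
        · rw [Function.update_of_ne hne]
          exact hP w' (by simp [hne, h]))
    have hPw : P = Pi.mulSingle w (P w) * Function.update P w 1 := by
      funext w'
      rcases eq_or_ne w' w with rfl | hne
      · simp
      · simp [hne]
    let h : Fin (k + 1) × List (Fin k) → Perm (Fin k) →* rootedAut k := fun w =>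
      (levelPerm k v.2.length).comp
        (MonoidHom.mulSingle (fun _ : Fin (k + 1) × List (Fin k) => Perm (Fin k)) w)
    have hcomm : ∀ σ τ : Perm (Fin k), Commute (h v σ) (h w τ) := fun σ τ =>
      (Pi.mulSingle_commute (f := fun _ => Perm (Fin k)) hv.1 σ τ).map (levelPerm k v.2.length)
    set U := levelPerm k v.2.length (Function.update P w 1)
    have he' : h v e * U ∈ L := by rwa [map_mul] at he
    have hgoal : ∀ e, levelPerm k v.2.length (Pi.mulSingle v e * P) = h v e * (h w (P w) * U) :=
      fun e => (congrArg _ (congrArg _ hPw)).trans (by rw [map_mul, map_mul]; rfl)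
    simp only [hgoal]
    by_cases hs : P w ∈ alternatingGroup (Fin k)
    · refine ⟨e, ?_⟩
      rw [← mul_assoc, (hcomm e (P w)).eq, mul_assoc]
      exact L.mul_mem (levelPerm_mulSingle_mem hk hnorm hroot v.2.length w hs) he'
    · have hab : (⟨0, by omega⟩ : Fin k) ≠ ⟨1, by omega⟩ := by simp
      obtain ⟨τ, hτ', hτ⟩ : ∃ τ : Perm (Fin k), P w * τ ∈ alternatingGroup (Fin k) ∧ τ * τ = 1 :=
        ⟨_, mul_swap_mem_alternatingGroup hab hs, swap_mul_self _ _⟩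
      refine ⟨τ * e, ?_⟩
      have h1 : h w (P w * τ) ∈ L := levelPerm_mulSingle_mem hk hnorm hroot v.2.length w hτ'
      have h2 : h v τ * h w τ ∈ L := by
        have := levelPerm_mulSingle_mul_mulSingle_mem hk hnorm hroot hτ v w
          (hlen w (Finset.mem_insert_self _ _)).symm
        rwa [map_mul] at this
      have h3 : h w τ * h w τ = 1 := by rw [← map_mul, hτ, map_one]
      have h4 : h v (τ * e) * (h w (P w) * U) =
          h w (P w * τ) * ((h v τ * h w τ) * (h v e * U)) := by
        rw [← mul_assoc, (hcomm (τ * e) (P w)).eq, (hcomm τ τ).eq, map_mul (h v), map_mul (h w)]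
        simp only [mul_assoc]
        rw [← mul_assoc (h w τ) (h w τ), h3, one_mul]
      rw [h4]
      exact L.mul_mem h1 (L.mul_mem h2 he')

/-- If the permutations of the children of the vertices of a level are even in total, then they
belong to `L`. -/
theorem levelPerm_mem_of_sign_eq_one (hk : 6 ≤ k) (hle : L ≤ positiveAut k)
    (hnorm : ∀ x ∈ L, ∀ g ∈ positiveAut k, g * x * g⁻¹ ∈ L)
    (hroot : ∀ σ ∈ alternatingGroup (Fin (k + 1)), rootPerm k σ ∈ L) {m : ℕ}
    (P : Fin (k + 1) × List (Fin k) → Perm (Fin k)) (hP : ∀ v, v.2.length ≠ m → P v = 1)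
    (hsign : Perm.sign (sphereAction k (m + 2) (levelPerm k m P)) = 1) :
    levelPerm k m P ∈ L := by
  classical
  obtain ⟨v, rfl⟩ : ∃ v : Fin (k + 1) × List (Fin k), v.2.length = m :=
    ⟨(0, List.replicate m ⟨0, by omega⟩), List.length_replicate⟩
  have hfin : {w : Fin (k + 1) × List (Fin k) | w.2.length = v.2.length}.Finite :=
    ((Set.finite_univ (α := Fin (k + 1))).prod
      (List.finite_length_eq (Fin k) v.2.length)).subset fun w hw => ⟨trivial, hw⟩
  obtain ⟨e, he⟩ := exists_levelPerm_mulSingle_mul_mem hk hnorm hroot v (hfin.toFinset.erase v)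
    (Finset.notMem_erase v _)
    (fun w hw => by simpa using (Finset.mem_of_mem_erase hw)) (Function.update P v 1) (by
      intro w hw
      rcases eq_or_ne w v with rfl | hne
      · rw [Function.update_self]
      · rw [Function.update_of_ne hne]
        refine hP w fun h => hw ?_
        rw [Finset.mem_erase]
        exact ⟨hne, by simpa using h⟩)
  set Q := Pi.mulSingle v e * Function.update P v 1 with hQ
  have hPQ : P = Pi.mulSingle v (P v * e⁻¹) * Q := by
    rw [hQ, ← mul_assoc, ← Pi.mulSingle_mul, inv_mul_cancel_right]
    funext w
    rcases eq_or_ne w v with rfl | hne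
    · simp
    · simp [hne]
  have hf : P v * e⁻¹ ∈ alternatingGroup (Fin k) := by
    by_contra hodd
    have hab : (⟨0, by omega⟩ : Fin k) ≠ ⟨1, by omega⟩ := by simp
    have h1 := levelPerm_mulSingle_mem hk hnorm hroot v.2.length v
        (mul_swap_mem_alternatingGroup hab hodd)
    have h2 := mem_positiveAut.mp (hle h1) (v.2.length + 2) (by omega)
    have h3 := mem_positiveAut.mp (hle he) (v.2.length + 2) (by omega)
    rw [hPQ, map_mul, map_mul, map_mul, h3, mul_one] at hsign
    rw [Pi.mulSingle_mul, map_mul, map_mul, map_mul, hsign, one_mul,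
      sign_sphereAction_levelPerm_mulSingle_swap v hab] at h2
    exact absurd h2 (by decide)
  rw [hPQ, map_mul]
  exact L.mul_mem (levelPerm_mulSingle_mem hk hnorm hroot _ v hf) he

end LevelPermutations

/-! ### Closed normal subgroups and continuous representations -/

section ClosedNormalSubgroups

open TreeVertex Equiv

variable {k : ℕ} {L : Subgroup (rootedAut k)}

theorem exists_rootPerm_eq (x : rootedAut k) :
    ∃ π : Perm (Fin (k + 1)), ∀ v, v.depth ≤ 1 → x.1 v = (rootPerm k π).1 v := by
  have h : ∀ i, ∃ i', x.1 (node i []) = node i' [] := by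
    intro i
    have h1 := rootedAut.isParent_apply x (IsParent.first i)
    rw [x.2] at h1
    generalize x.1 (node i []) = v at h1
    cases h1 with | first i' => exact ⟨i', rfl⟩
  choose f hf using h
  have hinj : Function.Injective f := fun i j hij => by
    have : x.1 (node i []) = x.1 (node j []) := by rw [hf, hf, hij]
    simpa using x.1.injective this
  refine ⟨Equiv.ofBijective f (Finite.injective_iff_bijective.mp hinj), fun v hv => ?_⟩
  match v, hv with
  | root, _ => exact x.2
  | node i [], _ => exact hf i
  | node i (a :: w), hv => simp [depth] at hv

theorem exists_levelPerm_eq {m : ℕ} (z : rootedAut k) (hz : ∀ v, v.depth ≤ m + 1 → z.1 v = v) :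
    ∃ P : Fin (k + 1) × List (Fin k) → Perm (Fin k), (∀ v, v.2.length ≠ m → P v = 1) ∧
      ∀ v, v.depth ≤ m + 2 → z.1 v = (levelPerm k m P).1 v := by
  classical
  have h : ∀ v : Fin (k + 1) × List (Fin k), v.2.length = m →
      ∃ σ : Perm (Fin k), ∀ a, z.1 (node v.1 (a :: v.2)) = node v.1 (σ a :: v.2) := by
    rintro ⟨i, u⟩ hu
    have h : ∀ a, ∃ a', z.1 (node i (a :: u)) = node i (a' :: u) := by
      intro a
      have h1 := rootedAut.isParent_apply z (IsParent.later i u a)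
      rw [hz (node i u) (by simpa [depth] using hu.le)] at h1
      generalize z.1 (node i (a :: u)) = v at h1
      cases h1 with | later _ _ a' => exact ⟨a', rfl⟩
    choose f hf using h
    have hinj : Function.Injective f := fun a b hab => by
      have : z.1 (node i (a :: u)) = z.1 (node i (b :: u)) := by rw [hf, hf, hab]
      simpa using z.1.injective this
    exact ⟨Equiv.ofBijective f (Finite.injective_iff_bijective.mp hinj), hf⟩
  choose σ hσ using h
  refine ⟨fun v => if hv : v.2.length = m then σ v hv else 1, fun v hv => dif_neg hv,
    fun v hv => ?_⟩
  rcases hv.eq_or_lt with hv' | hv'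
  · match v, hv' with
    | node i [], hv' => simp [depth] at hv'
    | node i (a :: w), hv' =>
      have hw : w.length = m := by simpa [depth] using hv'
      rw [levelPerm_node_cons _ _ _ hw, dif_pos hw]
      exact hσ (i, w) hw a
  · rw [levelPerm_of_depth_le _ (by omega), hz v (by omega)]

theorem sphereAction_congr {j : ℕ} {x y : rootedAut k} (h : ∀ v, v.depth ≤ j → x.1 v = y.1 v) :
    sphereAction k j x = sphereAction k j y := by
  ext ⟨v, hv⟩
  rw [regTree.dist_root] at hv
  exact h v hv.le

theorem sign_sphereAction_rootPerm (π : Perm (Fin (k + 1))) :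
    Perm.sign (sphereAction k 1 (rootPerm k π)) = Perm.sign π := by
  have hd : ∀ i : Fin (k + 1), (regTree k).dist root (node i []) = 1 := fun i => by
    rw [regTree.dist_root]; rfl
  let e : Fin (k + 1) → treeSphere k 1 := fun i => ⟨node i [], hd i⟩
  have he : Function.Bijective e := by
    refine ⟨fun i j h => by simpa [e] using h, ?_⟩
    rintro ⟨v, hv⟩
    have hv' := hv
    rw [regTree.dist_root] at hv'
    match v, hv' with
    | node i [], _ => exact ⟨i, rfl⟩
    | node i (a :: w), hv' => simp [depth] at hv'
  exact (Perm.sign_eq_sign_of_equiv π _ (Equiv.ofBijective e he) fun _ => rfl).symm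

/-- `L` is dense in the group of positive automorphisms: an element of `L` that agrees with `x` on a
ball can be corrected, on the sphere around it, by permutations of the children of the vertices of
one level; these are even in total. -/
theorem exists_mem_eq_on_ball (hk : 6 ≤ k) (hle : L ≤ positiveAut k)
    (hnorm : ∀ x ∈ L, ∀ g ∈ positiveAut k, g * x * g⁻¹ ∈ L)
    (hroot : ∀ σ ∈ alternatingGroup (Fin (k + 1)), rootPerm k σ ∈ L) (j : ℕ) {x : rootedAut k}
    (hx : x ∈ positiveAut k) : ∃ y ∈ L, ∀ v, v.depth ≤ j → x.1 v = y.1 v := by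
  induction j with
  | zero =>
    refine ⟨1, L.one_mem, fun v hv => ?_⟩
    match v, hv with
    | root, _ => exact x.2
  | succ j ih =>
    cases j with
    | zero =>
      obtain ⟨π, hπ⟩ := exists_rootPerm_eq x
      refine ⟨rootPerm k π, hroot π ?_, hπ⟩
      rw [Perm.mem_alternatingGroup, ← sign_sphereAction_rootPerm, ← sphereAction_congr hπ]
      exact mem_positiveAut.mp hx 1 le_rfl
    | succ m =>
      obtain ⟨y, hy, hxy⟩ := ih
      have hz : ∀ v, v.depth ≤ m + 1 → (y⁻¹ * x).1 v = v := fun v hv => by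
        change y.1.symm (x.1 v) = v
        rw [hxy v hv]
        exact y.1.symm_apply_apply v
      obtain ⟨P, hP, hzP⟩ := exists_levelPerm_eq _ hz
      refine ⟨y * levelPerm k m P, L.mul_mem hy
        (levelPerm_mem_of_sign_eq_one hk hle hnorm hroot P hP ?_), fun v hv => ?_⟩
      · rw [← sphereAction_congr hzP]
        exact mem_positiveAut.mp ((positiveAut k).mul_mem ((positiveAut k).inv_mem (hle hy)) hx) _
          (by omega)
      · change _ = y.1 ((levelPerm k m P).1 v)
        rw [← hzP v hv]
        exact (y.1.apply_symm_apply _).symm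

theorem positiveAut.isInducing_apply (k : ℕ) :
    Topology.IsInducing fun (x : positiveAut k) (v : TreeVertex k) => x.1.1 v :=
  (regTree.isInducing_apply k).comp
    (Topology.IsInducing.subtypeVal.comp Topology.IsInducing.subtypeVal)

theorem positiveAut.continuous_apply (v : TreeVertex k) :
    Continuous fun x : positiveAut k => x.1.1 v :=
  (_root_.continuous_apply v).comp (positiveAut.isInducing_apply k).continuous

theorem positiveAut.isEmbedding_apply (k : ℕ) :
    Topology.IsEmbedding fun (x : positiveAut k) (v : TreeVertex k) => x.1.1 v :=
  ⟨positiveAut.isInducing_apply k, fun _ _ h =>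
    Subtype.ext (rootedAut.ext_apply fun v => congrFun h v)⟩

instance positiveAut.t2Space (k : ℕ) : T2Space (positiveAut k) :=
  (positiveAut.isEmbedding_apply k).t2Space

instance positiveAut.totallyDisconnectedSpace (k : ℕ) : TotallyDisconnectedSpace (positiveAut k) :=
  (positiveAut.isEmbedding_apply k).isTotallyDisconnected_range.mp
    (isTotallyDisconnected_of_totallyDisconnectedSpace _)

/-- The even permutations of the subtrees below the root. -/
noncomputable def evenRootPerm (hk : 6 ≤ k) : alternatingGroup (Fin (k + 1)) →* positiveAut k :=
  ((rootPerm k).comp (alternatingGroup (Fin (k + 1))).subtype).codRestrict (positiveAut k)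
    (map_alternatingGroup_mem_positiveAut (by simp; omega) _)

theorem eq_top_of_evenRootPerm_mem (hk : 6 ≤ k) {N : Subgroup (positiveAut k)} (hN : N.Normal)
    (hclosed : IsClosed (N : Set (positiveAut k))) (hroot : ∀ σ, evenRootPerm hk σ ∈ N) :
    N = ⊤ := by
  rw [eq_top_iff]
  rintro x -
  have hx : ∀ j, ∃ y ∈ N, ∀ v, v.depth ≤ j → x.1.1 v = y.1.1 v := by
    intro j
    obtain ⟨_, ⟨y, hy, rfl⟩, h⟩ := exists_mem_eq_on_ball (L := N.map (positiveAut k).subtype) hk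
      (by rintro _ ⟨y, -, rfl⟩; exact y.2)
      (by rintro _ ⟨y, hy, rfl⟩ g hg; exact ⟨_, hN.conj_mem y hy ⟨g, hg⟩, rfl⟩)
      (fun σ hσ => ⟨_, hroot ⟨σ, hσ⟩, rfl⟩) j x.2
    exact ⟨y, hy, h⟩
  choose y hyN hy using hx
  refine hclosed.mem_of_tendsto (f := y) (b := Filter.atTop) ?_ (Filter.Eventually.of_forall hyN)
  rw [(positiveAut.isInducing_apply k).tendsto_nhds_iff, tendsto_pi_nhds]
  intro v
  refine tendsto_const_nhds.congr' ?_
  filter_upwards [Filter.eventually_ge_atTop v.depth] with j hj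
  exact hy j v hj

/-- A continuous representation of degree less than `k - 1` is trivial on the even permutations of
the `k + 1` subtrees below the root, hence on every positive automorphism. -/
theorem positiveAut_representation_eq_one (hk : 6 ≤ k) {d : ℕ} (hd : d < k - 1)
    (ρ : positiveAut k →* GL (Fin d) ℂ) (hρ : Continuous ρ) : ρ = 1 := by
  have hker : ρ.ker = ⊤ := by
    refine eq_top_of_evenRootPerm_mem hk inferInstance (isClosed_singleton.preimage hρ) fun σ => ?_
    let toEnd : GL (Fin d) ℂ →* Module.End ℂ (Fin d → ℂ) :=
      (Matrix.toLinAlgEquiv' : Matrix (Fin d) (Fin d) ℂ ≃ₐ[ℂ] _).toMonoidHom.comp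
        (Units.coeHom _)
    have := alternatingGroup_representation_eq_one (α := Fin (k + 1)) (by simp; omega)
      (by simp; omega) (toEnd.comp (ρ.comp (evenRootPerm hk)))
    have h1 : toEnd (ρ (evenRootPerm hk σ)) = 1 := DFunLike.congr_fun this σ
    refine MonoidHom.mem_ker.mpr (Units.ext ?_)
    exact Matrix.toLinAlgEquiv'.injective (h1.trans (map_one _).symm)
  ext1 x
  exact MonoidHom.mem_ker.mp (hker ▸ Subgroup.mem_top x)

end ClosedNormalSubgroups

/-! ### The product-free measure -/

section ProductFree

open TreeVertex Equiv

variable {k : ℕ}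

/-- The index of the child of the root below which a vertex lies (`0` for the root itself). -/
def TreeVertex.firstStep : TreeVertex k → Fin (k + 1)
  | root => 0
  | node i _ => i

/-- The positive automorphisms that take one child of the root to another one are a product-free
set, as a product of two of them does not take the first child to the second. -/
theorem exists_productFree_measureReal_eq (hk : 6 ≤ k) :
    ∃ A : Set (positiveAut k), MeasurableSet A ∧ A ∩ (A * A) = ∅ ∧
      (normalizedHaar (positiveAut k)).real A = 1 / ((k : ℝ) + 1) := by
  let μ := normalizedHaar (positiveAut k)
  let π : positiveAut k → Fin (k + 1) := fun x => (x.1.1 (node 0 [])).firstStep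
  have hfib : ∀ i, MeasurableSet (π ⁻¹' {i}) := fun i =>
    ((isOpen_discrete {v : TreeVertex k | v.firstStep = i}).preimage
      (positiveAut.continuous_apply (node 0 []))).measurableSet
  have hπ : ∀ (x : positiveAut k) i, π x = i ↔ x.1.1 (node 0 []) = node i [] := by
    intro x i
    obtain ⟨σ, hσ⟩ := exists_rootPerm_eq x.1
    have h : x.1.1 (node 0 []) = node (σ 0) [] := hσ _ le_rfl
    simp only [π, h, firstStep, node.injEq, and_true]
  have heq : ∀ i, μ.real (π ⁻¹' {i}) = μ.real (π ⁻¹' {0}) := by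
    intro i
    obtain ⟨σ, hσ, -⟩ := exists_even_apply_eq (S := Finset.univ) (by simp; omega)
      (Finset.mem_univ (0 : Fin (k + 1))) (Finset.mem_univ i)
    rw [← normalizedHaar_real_preimage_mul (evenRootPerm hk σ)]
    congr 1
    ext x
    obtain ⟨τ, hτ⟩ := exists_rootPerm_eq x.1
    have h : x.1.1 (node 0 []) = node (τ 0) [] := hτ _ le_rfl
    simp only [Set.mem_preimage, Set.mem_singleton_iff, hπ]
    change (rootPerm k σ).1 (x.1.1 (node 0 [])) = _ ↔ _
    rw [h, rootPerm_node]
    simp only [node.injEq, and_true]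
    rw [← hσ, σ.1.injective.eq_iff]
  have hsum := measureReal_eq_sum_inter_fiber μ hfib MeasurableSet.univ
  simp only [Set.univ_inter, heq, Finset.sum_const, Finset.card_univ, Fintype.card_fin,
    nsmul_eq_mul, MeasureTheory.probReal_univ] at hsum
  let a : Fin (k + 1) := ⟨1, by omega⟩
  refine ⟨π ⁻¹' {a}, hfib a, ?_, ?_⟩
  · rw [Set.eq_empty_iff_forall_notMem]
    rintro _ ⟨hxy, x, hx, y, hy, rfl⟩
    rw [Set.mem_preimage, Set.mem_singleton_iff, hπ] at hxy hx hy
    have h1 : x.1.1 (y.1.1 (node 0 [])) = node a [] := hxy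
    rw [hy, ← hx] at h1
    have h2 := hx.symm.trans (x.1.1.injective h1)
    rw [node.injEq] at h2
    exact absurd (congrArg Fin.val h2.1) one_ne_zero
  · rw [eq_div_iff (by positivity), mul_comm, ← Nat.cast_succ]
    exact (congrArg _ (heq a)).trans hsum.symm

end ProductFree

theorem theorem7 (k : ℕ) (hk : 6 ≤ k) :
    1 / ((k : ℝ) + 1) ≤ productFreeMeasure (positiveAut k) ∧
    productFreeMeasure (positiveAut k) ≤ 1 / ((k : ℝ) - 1) ^ ((1 : ℝ) / 3) ∧
    ∀ (d : ℕ) (ρ : positiveAut k →* GL (Fin d) ℂ), Continuous ρ → ρ ≠ 1 → k - 1 ≤ d := by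
  have hrep : ∀ (d : ℕ) (ρ : positiveAut k →* GL (Fin d) ℂ),
      Continuous ρ → ρ ≠ 1 → k - 1 ≤ d := by
    intro d ρ hρ hne
    by_contra! hd
    exact hne (positiveAut_representation_eq_one hk hd ρ hρ)
  have hcast : ((k - 1 : ℕ) : ℝ) = (k : ℝ) - 1 := by
    rw [Nat.cast_sub (by omega), Nat.cast_one]
  have hle : ∀ A : Set (positiveAut k), MeasurableSet A → A ∩ (A * A) = ∅ →
      (normalizedHaar (positiveAut k)).real A ≤ 1 / ((k : ℝ) - 1) ^ ((1 : ℝ) / 3) :=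
    fun A hA hfree => hcast ▸ measureReal_le_of_productFree (by omega) hrep hA hfree
  obtain ⟨A, hA, hfree, hμ⟩ := exists_productFree_measureReal_eq hk
  refine ⟨?_, ?_, hrep⟩
  · refine le_csSup ⟨1 / ((k : ℝ) - 1) ^ ((1 : ℝ) / 3), ?_⟩ ⟨A, hA, hfree, hμ.symm⟩
    rintro _ ⟨B, hB, hBfree, rfl⟩
    exact hle B hB hBfree
  · refine csSup_le ⟨_, A, hA, hfree, rfl⟩ ?_
    rintro _ ⟨B, hB, hBfree, rfl⟩
    exact hle B hB hBfree
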